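/- Let $S$ be a countable set, $\Delta\notin S$, and let $X=(X_n)_{n\ge 0}$ be a Markov chain on $S\cup\{\Delta\}$ with transition function $p$, for which $\Delta$ is absorbing and the restriction of $p$ to $S$ is irreducible. Write $P_\mu,E_\mu$ for the law and expectation with initial distribution $\mu$ (and $P_x,E_x$ when $\mu=\delta_x$), and for $x\in S\cup\{\Delta\}$ and $K\subseteq S$ let $\tau_x=\inf\{n\ge 1: X_n=x\}$, $\tau_K=\inf\{n\ge1: X_n\in K\}$. Assume that $E_x[e^{\beta\tau_\Delta}]<\infty$ for some $\beta>0$ and some $x\in S$. Put $$\lambda_{cr}=\sup\{\lambda>0: E_x[e^{\lambda\tau_\Delta}]<\infty\text{ for some }x\in S\};$$ $\lambda_{cr}$ is said to be in the infinite regime if $E_x[e^{\lambda_{cr}\tau_\Delta}]=\infty$ for some $x\in S$. A quasistationary distribution (QSD) is a probability measure $\nu$ on $S$ with $P_\nu(X_n\in\cdot\mid\tau_\Delta>n)=\nu$ for all $n\ge 1$; its absorption parameter is the $\lambda>0$ with $\sum_{i\in S}\nu(i)p(i,j)=e^{-\lambda}\nu(j)$ for all $j\in S$, and a QSD is minimal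 if its absorption parameter is $\lambda_{cr}$. **Theorem.** Suppose that there are $\bar\lambda>0$ and a nonempty finite $K\subsetneq S$ such that $$E_x[e^{\bar\lambda\tau_\Delta}]=\infty\ \text{ for some }x\in S,\qquad \sup_{x\in S\setminus K}E_x\big[e^{\bar\lambda(\tau_\Delta\wedge\tau_K)}\big]<\infty .$$ Then: 1. $\lambda_{cr}\in(0,\bar\lambda]$ and $\lambda_{cr}$ is in the infinite regime. Moreover $E_x[e^{\lambda_{cr}(\tau_\Delta\wedge\tau_x)}]<\infty$ for some $x\in S$; $E_x[e^{\lambda_{cr}\tau_x}\tau_x;\ \tau_x<\tau_\Delta]<\infty$ for some $x\in S$; and $E_x[e^{\lambda_{cr}(\tau_\Delta\wedge\tau_K)}]<\infty$ for all $x\in S\setminus K$. 2. There exists a unique QSD $\nu_{cr}$. It is minimal and is given by $$\nu_{cr}(x)=\frac{e^{\lambda_{cr}}-1}{E_x[e^{\lambda_{cr}\tau_\Delta};\ \tau_\Delta<\tau_x]},\qquad x\in S .$$ If, in addition, $p$ is aperiodic on $S$ and there are $x_0\in S$ and $n_0\ge 1$ such that $$\inf_{x\in S}\frac{P_x(\tau_\Delta>\tau_{x_0})}{P_x(\tau_\Delta>n_0)}>0,$$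 then for every probability measure $\mu$ on $S$, $\lim_{n\to\infty}P_\mu(X_n\in A\mid\tau_\Delta>n)=\nu_{cr}(A)$ for every $A\subseteq S$. -/

import Mathlib

open MeasureTheory ProbabilityTheory Filter Topology
open scoped ENNReal

namespace QSD

noncomputable section

/-- The state space `S ∪ {Δ}` is `Option S`, with `Δ = none`; it carries the discrete
σ-algebra. -/
instance instMeasurableSpaceState {S : Type*} : MeasurableSpace (Option S) := ⊤

instance instDiscreteState {S : Type*} : DiscreteMeasurableSpace (Option S) where
  forall_measurableSet _ := trivial

/-- The one-step Markov kernel of the transition function `p`. -/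
def stepKernel {S : Type*} (p : Option S → PMF (Option S)) : Kernel (Option S) (Option S) where
  toFun x := (p x).toMeasure
  measurable' := measurable_from_top

instance instMarkovStepKernel {S : Type*} (p : Option S → PMF (Option S)) :
    IsMarkovKernel (stepKernel p) where
  isProbabilityMeasure x := PMF.toMeasure.isProbabilityMeasure (p x)

/-- The kernel giving the law of `X (n+1)` from the history `(X 0, …, X n)`. -/
def historyKernel {S : Type*} (p : Option S → PMF (Option S)) (n : ℕ) :
    Kernel (∀ _ : Finset.Iic n, Option S) (Option S) :=
  (stepKernel p).comap (fun h => h ⟨n, Finset.mem_Iic.2 le_rfl⟩) (measurable_pi_apply _)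

instance instMarkovHistoryKernel {S : Type*} (p : Option S → PMF (Option S)) (n : ℕ) :
    IsMarkovKernel (historyKernel p n) := by
  unfold historyKernel; infer_instance

/-- The laws on path space of the Markov chain with transition function `p`, as a kernel from the
initial state: the trajectory from the one-point history `X 0 = x`. -/
def pathKernel {S : Type*} (p : Option S → PMF (Option S)) :
    Kernel (Option S) (ℕ → Option S) :=
  (Kernel.traj (X := fun _ => Option S) (historyKernel p) 0).comap (fun x _ => x)
    (measurable_pi_lambda _ fun _ => measurable_id)

/-- `P_x` for `x ∈ S`. -/
def PrAt {S : Type*} (p : Option S → PMF (Option S)) (x : S) : Measure (ℕ → Option S) :=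
  pathKernel p (some x)

/-- `P_μ` for an initial distribution `μ` on `S`. -/
def Pr {S : Type*} (p : Option S → PMF (Option S)) (μ : PMF S) : Measure (ℕ → Option S) :=
  (μ.map some).toMeasure.bind (pathKernel p)

/-- `τ_A = inf {n ≥ 1 : X n ∈ A}`, with value `⊤` if there is no such `n`. -/
def retTime {S : Type*} (A : Set (Option S)) (ω : ℕ → Option S) : ℕ∞ :=
  ⨅ (n : ℕ) (_ : 1 ≤ n ∧ ω n ∈ A), (n : ℕ∞)

/-- The absorption time `τ_Δ`. -/
def tauAbs {S : Type*} (ω : ℕ → Option S) : ℕ∞ := retTime {none} ω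

/-- The return time `τ_x` of `x ∈ S`. -/
def tau {S : Type*} (x : S) (ω : ℕ → Option S) : ℕ∞ := retTime {some x} ω

/-- The time `τ_K` for `K ⊆ S`. -/
def tauSet {S : Type*} (K : Set S) (ω : ℕ → Option S) : ℕ∞ := retTime (some '' K) ω

/-- `e^{l t}` for `l > 0` and a time `t ∈ {0, 1, …, ∞}`, equal to `∞` at `t = ∞`. -/
def expTime (l : ℝ) (t : ℕ∞) : ℝ≥0∞ :=
  if t = ⊤ then ⊤ else ENNReal.ofReal (Real.exp (l * (t.toNat : ℝ)))

/-- The `n`-step transition weights of the restriction of `p` to `S`. -/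
def restrictedStep {S : Type*} (p : Option S → PMF (Option S)) : ℕ → S → S → ℝ≥0∞
  | 0, x, y => PMF.pure x y
  | n + 1, x, y => ∑' z : S, restrictedStep p n x z * p (some z) (some y)

/-- The restriction of `p` to `S` is irreducible. -/
def IsIrreducibleOnS {S : Type*} (p : Option S → PMF (Option S)) : Prop :=
  ∀ x y : S, ∃ n : ℕ, 1 ≤ n ∧ 0 < restrictedStep p n x y

/-- Every state of `S` has period one: the greatest common divisor of its possible return times
is `1`. -/
def IsAperiodicOnS {S : Type*} (p : Option S → PMF (Option S)) : Prop :=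
  ∀ x : S, ∀ d : ℕ, (∀ n : ℕ, 1 ≤ n → 0 < restrictedStep p n x x → d ∣ n) → d = 1

/-- `E_x [exp (l τ_Δ)]`. -/
def absMGF {S : Type*} (p : Option S → PMF (Option S)) (l : ℝ) (x : S) : ℝ≥0∞ :=
  ∫⁻ ω, expTime l (tauAbs ω) ∂(PrAt p x)

/-- There are `β > 0` and `x ∈ S` with `E_x [exp (β τ_Δ)] < ∞`. -/
def HasExpMoment {S : Type*} (p : Option S → PMF (Option S)) : Prop :=
  ∃ b : ℝ, 0 < b ∧ ∃ x : S, absMGF p b x < ⊤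

/-- The critical absorption parameter. -/
def lambdaCr {S : Type*} (p : Option S → PMF (Option S)) : ℝ :=
  sSup {l : ℝ | 0 < l ∧ ∃ x : S, absMGF p l x < ⊤}

/-- The critical absorption parameter is in the infinite MGF regime. -/
def InfiniteRegime {S : Type*} (p : Option S → PMF (Option S)) : Prop :=
  ∃ x : S, absMGF p (lambdaCr p) x = ⊤

/-- `P_μ (X n ∈ A | τ_Δ > n)`. -/
def condLaw {S : Type*} (p : Option S → PMF (Option S)) (μ : PMF S) (n : ℕ) (A : Set S) : ℝ≥0∞ :=
  (cond (Pr p μ) {ω | (n : ℕ∞) < tauAbs ω}) {ω | ω n ∈ some '' A}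

/-- `ν` is a quasistationary distribution: `P_ν (X n ∈ · | τ_Δ > n) = ν` for all `n ≥ 1`. -/
def IsQSD {S : Type*} (p : Option S → PMF (Option S)) (ν : PMF S) : Prop :=
  ∀ n : ℕ, 1 ≤ n → ∀ A : Set S, condLaw p ν n A = ν.toOuterMeasure A

/-- `l` is the absorption parameter of `ν`: `l > 0` and `∑ i, ν i * p i j = e^{-l} * ν j` for
all `j ∈ S`. -/
def HasAbsorptionParameter {S : Type*} (p : Option S → PMF (Option S)) (ν : PMF S) (l : ℝ) :
    Prop :=
  0 < l ∧ ∀ j : S, ∑' i : S, ν i * p (some i) (some j) = ENNReal.ofReal (Real.exp (-l)) * ν j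

/-- A minimal QSD is a QSD with absorption parameter `lambdaCr p`. -/
def IsMinimalQSD {S : Type*} (p : Option S → PMF (Option S)) (ν : PMF S) : Prop :=
  IsQSD p ν ∧ HasAbsorptionParameter p ν (lambdaCr p)

end

end QSD

namespace QSD

noncomputable section

/-! The argument runs on the kernel q = e^λ p restricted to S (`tilt`). A geometric sum turns
exponential moments into potentials: E_x[e^{λτ_Δ}] = 1 + (e^λ - 1) Σ_n q^n 1(x) (`absMGF_eq`).
Moments stopped at τ_K become potentials of `tab K q`, which kills entry into K but not departure
from it, as befits times counted from 1; `hit q x y` is E_y[e^{λτ_x}; τ_x < τ_Δ]. A potential is the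
least u with f + q u ≤ u (`pot_le`), so bounds come from exhibiting supersolutions.

Take λ = λ_cr. The arrival condition bounds the potential of q killed on K. If the full potential
were finite, it would be bounded on the finite set K, hence everywhere (`pot_le_mul_pot_tab`), and a
bounded potential survives a slight increase of λ (`exists_pot_const_mul_le`), against the
definition of λ_cr: this is the infinite regime. Letting λ increase to λ_cr gives `hit q x x` ≤ 1,
so `hit q x` is a finite positive superharmonic function. Together with the bound for the kernel
killed on K it makes the excursion weight `pot (tab {x} q) 1` finite
(`Irr.pot_tab_singleton_ne_top`), then bounded. Were `hit q x x` < 1, summing over visits to x would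
make the full potential finite; so it equals 1. Thus q is recurrent with finite excursion weights
and has a unique invariant probability ν, with ν(x) the inverse of `pot (tab {x} q) 1 x`.

A QSD is a left eigenvector of p on S with some eigenvalue c, and the potential at λ integrates
against it to Σ_n (e^λ c)^n. This is infinite at λ_cr and finite below, where potentials are
bounded, so c = e^{-λ_cr} and the QSD is ν. The formula for ν is a mass balance over one excursion
(`mul_pot_kill`).

For the limit, h = `hit q x₀` is bounded and harmonic. Its Doob transform is an aperiodic positive
recurrent stochastic matrix with invariant law proportional to νh, so q^n f(x) tends to h(x)
ν(f)/ν(h) whenever f ≤ C h. The extra hypothesis yields q^{n₀} 1 ≤ C h, so numerator and denominator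
of the conditional law both converge. -/

open Classical in
/-- The indicator function of a point. -/
def pt {S : Type*} (y x : S) : ℝ≥0∞ := if x = y then 1 else 0

/-- The action of a nonnegative kernel on functions. -/
def app {S : Type*} (q : S → S → ℝ≥0∞) (f : S → ℝ≥0∞) (x : S) : ℝ≥0∞ := ∑' y, q x y * f y

/-- Powers of a nonnegative kernel. -/
def kpow {S : Type*} (q : S → S → ℝ≥0∞) : ℕ → S → S → ℝ≥0∞
  | 0, x, y => pt y x
  | n + 1, x, y => ∑' z, kpow q n x z * q z y

/-- The potential `∑ n, q ^ n f`. -/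
def pot {S : Type*} (q : S → S → ℝ≥0∞) (f : S → ℝ≥0∞) (x : S) : ℝ≥0∞ :=
  ∑' n, (app q)^[n] f x

/-- The Green kernel `∑ n, q ^ n`. -/
def green {S : Type*} (q : S → S → ℝ≥0∞) (x y : S) : ℝ≥0∞ := ∑' n, kpow q n x y

open Classical in
/-- The kernel `q` killed on entering `B`. -/
def tab {S : Type*} (B : Set S) (q : S → S → ℝ≥0∞) (x y : S) : ℝ≥0∞ := if y ∈ B then 0 else q x y

/-- The function whose value at `y` is the total weight of the paths from `y` that end at their
first visit to `x`. -/
def hit {S : Type*} (q : S → S → ℝ≥0∞) (x : S) : S → ℝ≥0∞ := pot (tab {x} q) (fun y => q y x)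

/-- Irreducibility of a nonnegative kernel. -/
def Irr {S : Type*} (q : S → S → ℝ≥0∞) : Prop := ∀ x y : S, ∃ n : ℕ, 1 ≤ n ∧ 0 < kpow q n x y

/-! ### Calculus of nonnegative kernels: powers, potentials, superharmonic functions. -/

section Algebra

variable {S : Type*} (q : S → S → ℝ≥0∞)

theorem pt_of_ne {x y : S} (h : x ≠ y) : pt y x = 0 := by simp [pt, h]

theorem tsum_pt_mul (x : S) (f : S → ℝ≥0∞) : ∑' y, pt y x * f y = f x := by
  rw [tsum_eq_single x (fun y hy => by simp [pt, hy.symm])]; simp [pt]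

theorem tsum_mul_pt (x : S) (f : S → ℝ≥0∞) : ∑' y, f y * pt x y = f x := by
  rw [tsum_eq_single x (fun y hy => by simp [pt, hy])]; simp [pt]

theorem app_add (f g : S → ℝ≥0∞) (x : S) :
    app q (fun y => f y + g y) x = app q f x + app q g x := by
  simp only [app, mul_add, ENNReal.tsum_add]

theorem app_const_mul (c : ℝ≥0∞) (f : S → ℝ≥0∞) (x : S) :
    app q (fun y => c * f y) x = c * app q f x := by
  simp only [app, ← ENNReal.tsum_mul_left]
  exact tsum_congr fun y => by ring

theorem app_tsum {ι : Type*} (f : ι → S → ℝ≥0∞) (x : S) :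
    app q (fun y => ∑' i, f i y) x = ∑' i, app q (f i) x := by
  simp only [app, ← ENNReal.tsum_mul_left]
  exact ENNReal.tsum_comm

variable {q} in
theorem app_mono {q' : S → S → ℝ≥0∞} {f g : S → ℝ≥0∞} (hq : ∀ x y, q x y ≤ q' x y)
    (h : ∀ y, f y ≤ g y) (x : S) : app q f x ≤ app q' g x :=
  ENNReal.tsum_le_tsum fun y => mul_le_mul' (hq x y) (h y)

variable {q} in
theorem app_le_app {f g : S → ℝ≥0∞} (h : ∀ y, f y ≤ g y) (x : S) : app q f x ≤ app q g x :=
  app_mono (fun _ _ => le_rfl) h x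

theorem app_iterate (n : ℕ) (f : S → ℝ≥0∞) (x : S) :
    (app q)^[n] f x = ∑' y, kpow q n x y * f y := by
  induction n generalizing f with
  | zero => simp [kpow, tsum_pt_mul]
  | succ n ih =>
    rw [Function.iterate_succ_apply, ih]
    simp only [app, kpow, ← ENNReal.tsum_mul_left, ← ENNReal.tsum_mul_right]
    rw [ENNReal.tsum_comm]
    exact tsum_congr fun y => tsum_congr fun z => by ring

theorem kpow_eq_iterate (n : ℕ) (x y : S) : kpow q n x y = (app q)^[n] (pt y) x := by
  rw [app_iterate, tsum_mul_pt]

theorem kpow_add (m n : ℕ) (x y : S) :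
    kpow q (m + n) x y = ∑' z, kpow q m x z * kpow q n z y := by
  rw [kpow_eq_iterate, Function.iterate_add_apply, app_iterate]
  exact tsum_congr fun z => by rw [kpow_eq_iterate q n]

theorem kpow_one (x y : S) : kpow q 1 x y = q x y := by simp [kpow, tsum_pt_mul]

theorem kpow_succ_left (n : ℕ) (x y : S) :
    kpow q (n + 1) x y = ∑' z, q x z * kpow q n z y := by
  rw [add_comm, kpow_add]
  simp only [kpow_one]

theorem mul_kpow_le (m n : ℕ) (x y z : S) : kpow q m x z * kpow q n z y ≤ kpow q (m + n) x y := by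
  rw [kpow_add]; exact ENNReal.le_tsum z

theorem kpow_swap (n : ℕ) (x y : S) : kpow (fun a b => q b a) n y x = kpow q n x y := by
  induction n generalizing x with
  | zero => simp only [kpow, pt]; congr 1; exact propext eq_comm
  | succ n ih =>
    rw [kpow, kpow_succ_left]
    exact tsum_congr fun z => by rw [ih, mul_comm]

theorem kpow_const_mul (c : ℝ≥0∞) (n : ℕ) (x y : S) :
    kpow (fun a b => c * q a b) n x y = c ^ n * kpow q n x y := by
  induction n generalizing y with
  | zero => simp [kpow]
  | succ n ih =>
    simp only [kpow, ih, ← ENNReal.tsum_mul_left]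
    exact tsum_congr fun z => by ring

theorem tab_const_mul (c : ℝ≥0∞) (B : Set S) :
    tab B (fun a b => c * q a b) = fun a b => c * tab B q a b := by
  funext a b; simp only [tab]; split_ifs <;> simp

theorem tab_le (B : Set S) (x y : S) : tab B q x y ≤ q x y := by
  simp only [tab]; split_ifs <;> simp

variable {q} in
theorem kpow_mono {q' : S → S → ℝ≥0∞} (h : ∀ x y, q x y ≤ q' x y) (n : ℕ) (x y : S) :
    kpow q n x y ≤ kpow q' n x y := by
  induction n generalizing y with
  | zero => exact le_rfl
  | succ n ih => exact ENNReal.tsum_le_tsum fun z => mul_le_mul' (ih z) (h z y)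

theorem pot_eq (f : S → ℝ≥0∞) (x : S) : pot q f x = f x + app q (pot q f) x := by
  have h : app q (pot q f) x = ∑' n, (app q)^[n + 1] f x := by
    change app q (fun y => ∑' n, (app q)^[n] f y) x = _
    rw [app_tsum]
    simp only [Function.iterate_succ_apply']
  rw [h, pot, tsum_eq_zero_add' ENNReal.summable]
  simp

theorem pot_eq_add_pot_app (f : S → ℝ≥0∞) (x : S) : pot q f x = f x + pot q (app q f) x := by
  rw [pot, tsum_eq_zero_add' ENNReal.summable]
  simp only [Function.iterate_succ_apply, Function.iterate_zero, id, pot]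

theorem pot_eq_tsum_green (f : S → ℝ≥0∞) (x : S) : pot q f x = ∑' y, green q x y * f y := by
  simp only [pot, app_iterate, green, ← ENNReal.tsum_mul_right]
  exact ENNReal.tsum_comm

theorem pot_const_mul (c : ℝ≥0∞) (f : S → ℝ≥0∞) (x : S) :
    pot q (fun y => c * f y) x = c * pot q f x := by
  simp only [pot_eq_tsum_green, ← ENNReal.tsum_mul_left]
  exact tsum_congr fun y => by ring

theorem green_eq_pot (x y : S) : green q x y = pot q (pt y) x := by
  simp [pot_eq_tsum_green, tsum_mul_pt]

theorem pot_add (f g : S → ℝ≥0∞) (x : S) :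
    pot q (fun y => f y + g y) x = pot q f x + pot q g x := by
  simp only [pot_eq_tsum_green, mul_add, ENNReal.tsum_add]

variable {q} in
theorem pot_mono {q' : S → S → ℝ≥0∞} {f g : S → ℝ≥0∞} (hq : ∀ x y, q x y ≤ q' x y)
    (h : ∀ y, f y ≤ g y) (x : S) : pot q f x ≤ pot q' g x := by
  simp only [pot, app_iterate]
  exact ENNReal.tsum_le_tsum fun n => ENNReal.tsum_le_tsum fun y =>
    mul_le_mul' (kpow_mono hq n x y) (h y)

theorem le_pot (f : S → ℝ≥0∞) (x : S) : f x ≤ pot q f x := by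
  rw [pot_eq]; exact le_self_add

variable {q} in
/-- The potential is the least supersolution. -/
theorem pot_le {f u : S → ℝ≥0∞} (h : ∀ x, f x + app q u x ≤ u x) (x : S) : pot q f x ≤ u x := by
  refine ENNReal.tsum_le_of_sum_range_le fun N => ?_
  induction N generalizing x with
  | zero => simp
  | succ N ih =>
    rw [Finset.sum_range_succ']
    refine le_trans ?_ (h x)
    rw [add_comm]
    refine add_le_add (by simp) ?_
    refine le_trans (le_of_eq ?_) (app_le_app ih x)
    simp only [Function.iterate_succ_apply', app, Finset.mul_sum]
    rw [Summable.tsum_finsetSum fun _ _ => ENNReal.summable]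

theorem green_swap (x y : S) : green (fun a b => q b a) y x = green q x y := by
  simp only [green, kpow_swap]

theorem green_eq_left (x y : S) : green q x y = pt x y + ∑' z, green q x z * q z y := by
  rw [← green_swap, green_eq_pot, pot_eq]
  simp only [app]
  congr 1
  exact tsum_congr fun z => by rw [← green_eq_pot, green_swap, mul_comm]

variable {q} in
-- Minimality of the potential, applied to the transposed kernel: rows of the Green kernel are least
-- supersolutions for the action on measures.
theorem const_mul_green_le {v : S → ℝ≥0∞} {c : ℝ≥0∞} {x : S}
    (h : ∀ y, c * pt x y + ∑' z, v z * q z y ≤ v y) (y : S) : c * green q x y ≤ v y := by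
  rw [← green_swap, green_eq_pot, ← pot_const_mul]
  refine pot_le (fun y => ?_) y
  simpa only [app, mul_comm] using h y

variable {q} in
theorem iterate_le_of_superharmonic {h : S → ℝ≥0∞} (hh : ∀ x, app q h x ≤ h x) (n : ℕ) (x : S) :
    (app q)^[n] h x ≤ h x := by
  induction n generalizing x with
  | zero => simp
  | succ n ih =>
    rw [Function.iterate_succ_apply']
    exact (app_le_app ih x).trans (hh x)

variable {q} in
theorem kpow_mul_le_of_superharmonic {h : S → ℝ≥0∞} (hh : ∀ x, app q h x ≤ h x) (n : ℕ)
    (x y : S) : kpow q n x y * h y ≤ h x := by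
  refine le_trans ?_ (iterate_le_of_superharmonic hh n x)
  rw [app_iterate]
  exact ENNReal.le_tsum y

variable {q} in
theorem iterate_eq_of_harmonic {h : S → ℝ≥0∞} (hh : ∀ x, app q h x = h x) (n : ℕ) (x : S) :
    (app q)^[n] h x = h x := by
  have : app q h = h := funext hh
  rw [Function.iterate_fixed this]

variable {q} in
theorem Irr.const_mul (hirr : Irr q) {c : ℝ≥0∞} (hc : c ≠ 0) : Irr fun a b => c * q a b := by
  intro x y
  obtain ⟨n, hn, h⟩ := hirr x y
  refine ⟨n, hn, ?_⟩
  rw [kpow_const_mul]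
  exact ENNReal.mul_pos (pow_ne_zero n hc) h.ne'

variable {q} in
theorem Irr.pos_of_superharmonic (hirr : Irr q) {h : S → ℝ≥0∞} (hh : ∀ x, app q h x ≤ h x)
    {x : S} (hx : h x ≠ 0) (y : S) : h y ≠ 0 := by
  obtain ⟨n, -, hn⟩ := hirr y x
  exact ((ENNReal.mul_pos hn.ne' hx).trans_le (kpow_mul_le_of_superharmonic hh n y x)).ne'

variable {q} in
-- Each q^n(x, y) h(y) is at most h(x), so one finite value forces all. For potentials, finiteness
-- therefore does not depend on the starting point.
theorem Irr.ne_top_of_superharmonic (hirr : Irr q) {h : S → ℝ≥0∞} (hh : ∀ x, app q h x ≤ h x)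
    {x : S} (hx : h x ≠ ⊤) (y : S) : h y ≠ ⊤ := by
  obtain ⟨n, -, hn⟩ := hirr x y
  intro hy
  have := kpow_mul_le_of_superharmonic hh n x y
  rw [hy, ENNReal.mul_top hn.ne', top_le_iff] at this
  exact hx this

theorem app_pot_le (f : S → ℝ≥0∞) (x : S) : app q (pot q f) x ≤ pot q f x := by
  conv_rhs => rw [pot_eq]
  exact le_add_self

end Algebra

/-! ### Killed kernels, first-visit weights, recurrence and invariant measures. -/

section Taboo

variable {S : Type*} {q : S → S → ℝ≥0∞}

/-- A bounded Green potential stays bounded for a slightly larger kernel. -/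
theorem exists_pot_const_mul_le {D : ℝ≥0∞} (hD : D ≠ ⊤) (h : ∀ x, pot q 1 x ≤ D) :
    ∃ s : ℝ≥0∞, 1 < s ∧ s ≠ ⊤ ∧ ∀ x, pot (fun a b => s * q a b) 1 x ≤ 2 * D := by
  rcases isEmpty_or_nonempty S with hS | ⟨⟨x₀⟩⟩
  · exact ⟨2, by norm_num, by norm_num, fun x => hS.elim x⟩
  have hD0 : D ≠ 0 := by
    have : 1 ≤ D := (le_pot q 1 x₀).trans (h x₀)
    exact (zero_lt_one.trans_le this).ne'
  have h2D : 2 * D ≠ 0 := mul_ne_zero two_ne_zero hD0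
  have h2D' : 2 * D ≠ ⊤ := ENNReal.mul_ne_top (by norm_num) hD
  -- Twice the potential g is a supersolution for the enlarged kernel: the extra term (2D)⁻¹ · 2qg
  -- is at most 1 because qg ≤ D, and 1 + 2qg + 1 = 2g.
  refine ⟨1 + (2 * D)⁻¹, ENNReal.lt_add_right (by norm_num) (ENNReal.inv_ne_zero.2 h2D'),
    by simp [h2D], fun x => ?_⟩
  refine (pot_le (u := fun y => 2 * pot q 1 y) (fun y => ?_) x).trans (mul_le_mul' le_rfl (h x))
  have e : app (fun a b => (1 + (2 * D)⁻¹) * q a b) (fun y => 2 * pot q 1 y) y =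
      2 * app q (pot q 1) y + (2 * D)⁻¹ * (2 * app q (pot q 1) y) := by
    rw [← one_add_mul, ← app_const_mul, ← app_const_mul]
    simp only [app]
    exact tsum_congr fun z => by ring
  rw [e]
  have h1 : (2 * D)⁻¹ * (2 * app q (pot q 1) y) ≤ 1 :=
    (mul_le_mul' le_rfl (mul_le_mul' le_rfl ((app_pot_le q 1 y).trans (h y)))).trans
      (ENNReal.inv_mul_le_one _)
  calc (1 : S → ℝ≥0∞) y + (2 * app q (pot q 1) y + (2 * D)⁻¹ * (2 * app q (pot q 1) y))
      ≤ 1 + (2 * app q (pot q 1) y + 1) := by gcongr; rfl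
    _ = 2 * (1 + app q (pot q 1) y) := by ring
    _ = 2 * pot q 1 y := by conv_rhs => rw [pot_eq]; simp

/-- A potential that is bounded on `K` is controlled by the potential of the kernel killed
on `K`. -/
theorem pot_le_mul_pot_tab {T : S → S → ℝ≥0∞} (hT : ∀ x y, T x y ≤ q x y) {R : ℝ≥0∞}
    (hR : ∀ x, ∑' y, q x y ≤ R) (K : Set S) {m : ℝ≥0∞} (hm : ∀ k ∈ K, pot T 1 k ≤ m) (x : S) :
    pot T 1 x ≤ (1 + R * m) * pot (tab K q) 1 x := by
  set c := 1 + R * m with hc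
  -- The minimum of the two sides is itself a supersolution: a step into `K` is charged `m`, a step
  -- elsewhere the killed potential. Minimality then gives the bound with no a priori finiteness off
  -- `K`.
  refine (pot_le (q := T) (f := 1) (u := fun y => min (pot T 1 y) (c * pot (tab K q) 1 y))
    (fun y => ?_) x).trans (min_le_right _ _)
  refine le_min ?_ ?_
  · rw [pot_eq]
    gcongr
    exact app_le_app (fun z => min_le_left _ _) y
  · have h1 : app T (fun y => min (pot T 1 y) (c * pot (tab K q) 1 y)) y ≤
        R * m + c * app (tab K q) (pot (tab K q) 1) y := by
      rw [← app_const_mul]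
      calc _ ≤ ∑' z, (q y z * m + tab K q y z * (c * pot (tab K q) 1 z)) := by
            refine ENNReal.tsum_le_tsum fun z => ?_
            by_cases hz : z ∈ K
            · exact (mul_le_mul' (hT y z) ((min_le_left _ _).trans (hm z hz))).trans le_self_add
            · refine le_trans ?_ le_add_self
              have : tab K q y z = q y z := by simp [tab, hz]
              rw [this]
              exact mul_le_mul' (hT y z) (min_le_right _ _)
        _ ≤ _ := by
            rw [ENNReal.tsum_add, ENNReal.tsum_mul_right]
            gcongr
            · exact hR y
            · rfl
    calc _ ≤ 1 + (R * m + c * app (tab K q) (pot (tab K q) 1) y) := by gcongr; rfl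
      _ = c * (1 + app (tab K q) (pot (tab K q) 1) y) := by rw [hc]; ring
      _ = c * pot (tab K q) 1 y := by
        congr 1; conv_rhs => rw [pot_eq]; simp

theorem app_eq_tab_add (x : S) (f : S → ℝ≥0∞) (y : S) :
    app q f y = app (tab {x} q) f y + q y x * f x := by
  rw [← tsum_mul_pt x (fun z => q y z * f z), app, app, ← ENNReal.tsum_add]
  refine tsum_congr fun z => ?_
  by_cases hz : z = x <;> simp [tab, pt, hz]

theorem hit_eq (x y : S) : hit q x y = q y x + app (tab {x} q) (hit q x) y := pot_eq _ _ _

/-- Splitting off the step into `x` shows that `h` is a supersolution for the kernel killed at `x`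
with source `q · x * h x`. -/
theorem mul_hit_le {h : S → ℝ≥0∞} (hh : ∀ x, app q h x ≤ h x) (x y : S) :
    h x * hit q x y ≤ h y := by
  rw [hit, ← pot_const_mul]
  refine pot_le (fun z => ?_) y
  refine le_trans (le_of_eq ?_) (hh z)
  rw [app_eq_tab_add (q := q) x h z]; ring

theorem hit_self_le_one {h : S → ℝ≥0∞} (hh : ∀ x, app q h x ≤ h x) {x : S} (h0 : h x ≠ 0)
    (h1 : h x ≠ ⊤) : hit q x x ≤ 1 := by
  have := mul_hit_le hh x x
  exact (ENNReal.mul_le_mul_iff_right h0 h1).1 (by simpa using this)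

theorem app_hit_le {x : S} (hx : hit q x x ≤ 1) (y : S) : app q (hit q x) y ≤ hit q x y := by
  rw [app_eq_tab_add x, hit_eq x y, add_comm]
  gcongr
  exact mul_le_of_le_one_right' hx

/-- The mass lost by killing at `x` is restored exactly when the return weight is one. This supplies
the harmonic function of the Doob transform. -/
theorem app_hit_eq {x : S} (hx : hit q x x = 1) (y : S) : app q (hit q x) y = hit q x y := by
  rw [app_eq_tab_add x, hit_eq x y, add_comm, hx, mul_one]

theorem Irr.hit_ne_zero (hirr : Irr q) {x : S} (hx : hit q x x ≤ 1) (y : S) : hit q x y ≠ 0 := by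
  obtain ⟨n, hn, h⟩ := hirr x x
  obtain ⟨m, rfl⟩ : ∃ m, n = m + 1 := ⟨n - 1, by omega⟩
  obtain ⟨z, hz⟩ : ∃ z, kpow q m x z * q z x ≠ 0 := by
    by_contra! hc
    rw [kpow, ENNReal.tsum_eq_zero.2 hc] at h
    exact lt_irrefl _ h
  refine hirr.pos_of_superharmonic (app_hit_le hx) (x := z) ?_ y
  rw [hit_eq]
  exact (lt_of_lt_of_le (pos_iff_ne_zero.2 (right_ne_zero_of_mul hz)) le_self_add).ne'

theorem hit_le {R : ℝ≥0∞} (hR : ∀ x, ∑' y, q x y ≤ R) (x y : S) :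
    hit q x y ≤ R * pot (tab {x} q) 1 y := by
  rw [hit, ← pot_const_mul]
  refine pot_mono (fun _ _ => le_rfl) (fun z => ?_) y
  simpa using (ENNReal.le_tsum (f := fun w => q z w) x).trans (hR z)

/-- If the kernel killed on a finite set `K` has a bounded potential and there is a finite positive
superharmonic function, then the kernel killed at a single point has a finite potential. -/
theorem Irr.pot_tab_singleton_ne_top (hirr : Irr q) {h : S → ℝ≥0∞}
    (hh : ∀ x, app q h x ≤ h x) (h0 : ∀ x, h x ≠ 0) (h1 : ∀ x, h x ≠ ⊤) {K : Set S}
    (hK : K.Finite) {C : ℝ≥0∞} (hC : C ≠ ⊤) (hu : ∀ x, pot (tab K q) 1 x ≤ C) (x y : S) :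
    pot (tab {x} q) 1 y ≠ ⊤ := by
  classical
  set t := tab {x} q with ht
  set s : S → ℝ≥0∞ := fun y => q y x * h x with hs
  have hsup : ∀ y, s y + app t h y ≤ h y := fun y => by
    rw [add_comm]; exact (app_eq_tab_add x h y).symm.le.trans (hh y)
  have hth : ∀ y, app t h y ≤ h y := fun y => le_add_self.trans (hsup y)
  have hitpos : ∀ y, pot t s y ≠ 0 := by
    intro y
    have e : pot t s y = h x * hit q x y := by
      rw [hit, ← pot_const_mul]; congr 1; funext z; simp [hs, mul_comm]
    rw [e]
    exact mul_ne_zero (h0 x) (hirr.hit_ne_zero (hit_self_le_one hh (h0 x) (h1 x)) y)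
  -- Partial sums of the iterates of `t`: `hN` loses at least `sN` under one step of `t`. By
  -- irreducibility `sN` is positive on the finite set `K` once `N` is large, whereas `s` itself may
  -- vanish there.
  let sN : ℕ → S → ℝ≥0∞ := fun N y => ∑ k ∈ Finset.range N, (app t)^[k] s y
  let hN : ℕ → S → ℝ≥0∞ := fun N y => ∑ k ∈ Finset.range N, (app t)^[k] h y
  have app_sum : ∀ (f : S → ℝ≥0∞) (N : ℕ) (y : S),
      ∑ k ∈ Finset.range (N + 1), (app t)^[k] f y =
        f y + app t (fun z => ∑ k ∈ Finset.range N, (app t)^[k] f z) y := by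
    intro f N y
    rw [Finset.sum_range_succ', add_comm]
    simp only [Function.iterate_zero, id]
    congr 1
    simp only [Function.iterate_succ_apply', app, Finset.mul_sum]
    rw [Summable.tsum_finsetSum fun _ _ => ENNReal.summable]
  have key : ∀ N y, sN N y + app t (hN N) y ≤ hN N y := by
    intro N
    induction N with
    | zero => intro y; simp [sN, hN, app]
    | succ N ih =>
      intro y
      have e1 : sN (N + 1) y = s y + app t (sN N) y := app_sum s N y
      have e2 : ∀ y, hN (N + 1) y = h y + app t (hN N) y := app_sum h N
      have e3 : app t (hN (N + 1)) y = app t h y + app t (app t (hN N)) y := by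
        rw [← app_add]; congr 1; funext z; exact e2 z
      rw [e1, e3, e2]
      calc s y + app t (sN N) y + (app t h y + app t (app t (hN N)) y)
          = (s y + app t h y) + app t (fun z => sN N z + app t (hN N) z) y := by
            rw [app_add]; ring
        _ ≤ _ := add_le_add (hsup y) (app_le_app ih y)
  have hNtop : ∀ N y, hN N y ≠ ⊤ := fun N y => by
    refine (ENNReal.sum_lt_top.2 fun k _ => ?_).ne
    exact (iterate_le_of_superharmonic hth k y).trans_lt (h1 y).lt_top
  obtain ⟨N, hNpos⟩ : ∃ N, ∀ k ∈ K, sN N k ≠ 0 := by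
    have : ∀ k, ∃ n, (app t)^[n] s k ≠ 0 := by
      intro k
      by_contra! hc
      exact hitpos k (ENNReal.tsum_eq_zero.2 hc)
    choose n hn using this
    refine ⟨hK.toFinset.sup n + 1, fun k hk => ?_⟩
    intro h0
    refine hn k ((Finset.sum_eq_zero_iff.1 h0) (n k) ?_)
    rw [Finset.mem_range, Nat.lt_succ_iff]
    exact Finset.le_sup (f := n) (hK.mem_toFinset.2 hk)
  obtain ⟨A, hA, hAC⟩ : ∃ A : ℝ≥0∞, A ≠ ⊤ ∧ ∀ k ∈ K, C ≤ A * sN N k := by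
    refine ⟨∑ k ∈ hK.toFinset, C / sN N k, ?_, fun k hk => ?_⟩
    · refine (ENNReal.sum_lt_top.2 fun k hk => ?_).ne
      exact ENNReal.div_lt_top hC (hNpos k (hK.mem_toFinset.1 hk))
    · have hfin : sN N k ≠ ⊤ := by
        have := (key N k)
        exact ((le_self_add.trans this).trans_lt (hNtop N k).lt_top).ne
      calc C = C / sN N k * sN N k := (ENNReal.div_mul_cancel (hNpos k hk) hfin).symm
        _ ≤ _ := by
          gcongr
          exact Finset.single_le_sum (f := fun k => C / sN N k) (fun _ _ => zero_le)
            (hK.mem_toFinset.2 hk)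
  set u := pot (tab K q) 1 with hu'
  -- Lyapunov function: `W`, the killed potential set to zero on `K`, satisfies the supersolution
  -- inequality except for an error `C` on `K`. The deficit `A * sN` of `A * hN` pays for that
  -- error, so `A * hN + W` dominates `pot t 1`.
  let W : S → ℝ≥0∞ := fun y => if y ∈ K then 0 else u y
  let I : S → ℝ≥0∞ := fun y => if y ∈ K then C else 0
  have hI : ∀ y, I y ≠ ⊤ := fun y => by simp only [I]; split_ifs <;> simp [hC]
  have hW : ∀ y, 1 + app t W y ≤ W y + I y := by
    intro y
    have e : app q W y = app (tab K q) u y := by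
      refine tsum_congr fun z => ?_
      simp only [W, tab]; split_ifs <;> simp
    have e2 : u y = 1 + app (tab K q) u y := pot_eq _ _ _
    have : 1 + app t W y ≤ u y := by
      rw [e2, ← e]; gcongr; exact app_mono (tab_le q _) (fun _ => le_rfl) y
    refine this.trans ?_
    by_cases hy : y ∈ K
    · simpa [W, I, hy] using hu y
    · simp [W, I, hy]
  have hsuper : ∀ y, (1 : S → ℝ≥0∞) y + app t (fun z => A * hN N z + W z) y ≤ A * hN N y + W y := by
    intro y
    refine (ENNReal.add_le_add_iff_right (hI y)).1 ?_
    rw [app_add, app_const_mul]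
    change 1 + (A * app t (hN N) y + app t W y) + I y ≤ _
    calc 1 + (A * app t (hN N) y + app t W y) + I y
        = (I y + A * app t (hN N) y) + (1 + app t W y) := by ring
      _ ≤ (A * sN N y + A * app t (hN N) y) + (W y + I y) := by
          refine add_le_add (add_le_add ?_ le_rfl) (hW y)
          by_cases hy : y ∈ K
          · simpa [I, hy] using hAC y hy
          · simp [I, hy]
      _ = A * (sN N y + app t (hN N) y) + (W y + I y) := by ring
      _ ≤ A * hN N y + (W y + I y) := by gcongr; exact key N y
      _ = _ := by ring
  refine ((pot_le hsuper y).trans_lt ?_).ne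
  refine ENNReal.add_lt_top.2 ⟨ENNReal.mul_lt_top hA.lt_top (hNtop N y).lt_top, ?_⟩
  simp only [W]
  split_ifs
  · simp
  · exact (hu y).trans_lt hC.lt_top

/-- Decomposition over visits to `x`: if the return weight L were below 1, then `H + c * hit q x`
with c = H(x)/(1 - L) would be a finite solution of the potential equation. -/
theorem one_le_hit_self {R : ℝ≥0∞} (hR1 : R ≠ ⊤) (hR : ∀ x, ∑' y, q x y ≤ R) {x : S}
    (hfin : ∀ y, pot (tab {x} q) 1 y ≠ ⊤) {y : S} (hinf : pot q 1 y = ⊤) : 1 ≤ hit q x x := by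
  by_contra! hL
  set L := hit q x x with hLdef
  set H := pot (tab {x} q) 1 with hH
  set c := H x * (1 - L)⁻¹ with hc
  have hc1 : c = H x + c * L := by
    have : (1 - L)⁻¹ = 1 + (1 - L)⁻¹ * L := by
      rw [← ENNReal.tsum_geometric, ← ENNReal.tsum_mul_right]
      simp only [← pow_succ]
      rw [tsum_eq_zero_add' ENNReal.summable, pow_zero]
    rw [hc]
    conv_lhs => rw [this]
    ring
  have hctop : c ≠ ⊤ := ENNReal.mul_ne_top (hfin x)
    (ENNReal.inv_ne_top.2 (tsub_pos_of_lt hL).ne')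
  have hF : hit q x y ≠ ⊤ :=
    ((hit_le hR x y).trans_lt (ENNReal.mul_lt_top hR1.lt_top (hfin y).lt_top)).ne
  have : pot q 1 y ≤ H y + c * hit q x y := by
    refine pot_le (u := fun y => H y + c * hit q x y) (fun z => le_of_eq ?_) y
    rw [app_eq_tab_add x, app_add, app_const_mul, ← hLdef, ← hc1]
    have e1 : H z = 1 + app (tab {x} q) H z := pot_eq _ _ _
    rw [e1, hit_eq x z]
    simp only [Pi.one_apply]; ring
  rw [hinf, top_le_iff] at this
  exact ENNReal.add_ne_top.2 ⟨hfin y, ENNReal.mul_ne_top hctop hF⟩ this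

theorem green_tab_self (x : S) : green (tab {x} q) x x = 1 := by
  rw [green_eq_left]; simp [pt, tab]

/-- The weight of an excursion from `x` spent at each point. Invariance away from `x` is the Green
equation; at `x` it says that the return weight is one. -/
theorem green_tab_invariant {x : S} (hx : hit q x x = 1) (y : S) :
    ∑' z, green (tab {x} q) x z * q z y = green (tab {x} q) x y := by
  by_cases hy : y = x
  · subst hy
    rw [green_tab_self, ← hx, hit, pot_eq_tsum_green]
  · rw [green_eq_left _ x y, pt_of_ne hy, zero_add]
    exact tsum_congr fun z => by simp [tab, hy]

theorem tsum_mul_kpow_of_invariant {v : S → ℝ≥0∞} {c : ℝ≥0∞}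
    (hv : ∀ y, ∑' z, v z * q z y = c * v y) (n : ℕ) (y : S) :
    ∑' z, v z * kpow q n z y = c ^ n * v y := by
  induction n generalizing y with
  | zero => simp [kpow, pt]
  | succ n ih =>
    simp only [kpow, ← ENNReal.tsum_mul_left]
    rw [ENNReal.tsum_comm]
    simp only [← mul_assoc, ENNReal.tsum_mul_right, ih]
    simp only [mul_assoc, ENNReal.tsum_mul_left, hv]
    ring

/-- Uniqueness of the invariant measure. -/
theorem Irr.eq_mul_green_of_invariant (hirr : Irr q) {x : S} (hx : hit q x x = 1)
    {v : S → ℝ≥0∞} (hvt : ∀ y, v y ≠ ⊤) (hv : ∀ y, ∑' z, v z * q z y = v y) (y : S) :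
    v y = v x * green (tab {x} q) x y := by
  have hle : ∀ y, v x * green (tab {x} q) x y ≤ v y := by
    refine const_mul_green_le fun y => ?_
    by_cases hy : y = x
    · subst hy; simp [tab, pt]
    · rw [pt_of_ne hy]
      simp only [mul_zero, zero_add]
      refine le_trans (ENNReal.tsum_le_tsum fun z => ?_) (hv y).le
      gcongr; exact tab_le q _ _ _
  -- A strict excess at `y` is carried to `x` by a path of positive weight, but the two invariant
  -- measures have the same finite value at `x`.
  by_contra hne
  have hlt := lt_of_le_of_ne (hle y) (Ne.symm hne)
  obtain ⟨n, -, hn⟩ := hirr y x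
  have e1 := tsum_mul_kpow_of_invariant (c := 1) (by simpa using hv) n x
  have e2 := tsum_mul_kpow_of_invariant (c := 1) (by simpa using green_tab_invariant hx) n x
  rw [one_pow, one_mul] at e1 e2
  rw [green_tab_self] at e2
  have hk : kpow q n y x ≠ ⊤ := by
    intro h
    have : v y * kpow q n y x ≤ v x := by rw [← e1]; exact ENNReal.le_tsum y
    rw [h, ENNReal.mul_top (zero_le.trans_lt hlt).ne', top_le_iff] at this
    exact hvt x this
  have : ∑' z, v x * green (tab {x} q) x z * kpow q n z x < ∑' z, v z * kpow q n z x := by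
    refine ENNReal.tsum_lt_tsum (i := y) ?_ (fun z => mul_le_mul' (hle z) le_rfl) ?_
    · simp only [mul_assoc, ENNReal.tsum_mul_left, e2, mul_one]; exact hvt x
    · exact (ENNReal.mul_lt_mul_iff_left hn.ne' hk).2 hlt
  simp only [mul_assoc, ENNReal.tsum_mul_left, e2, e1, mul_one] at this
  exact lt_irrefl _ this

end Taboo

/-! ### From the path measure to kernel powers. -/

section Paths

variable {S : Type*}

/-- The restriction of the transition function to `S`. -/
def onS (p : Option S → PMF (Option S)) (x y : S) : ℝ≥0∞ := p (some x) (some y)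

theorem restrictedStep_eq (p : Option S → PMF (Option S)) (n : ℕ) (x y : S) :
    restrictedStep p n x y = kpow (onS p) n x y := by
  induction n generalizing y with
  | zero =>
    simp only [restrictedStep, kpow, pt, PMF.pure_apply]
    congr 1; exact propext eq_comm
  | succ n ih => simp only [restrictedStep, kpow, ih, onS]

theorem tsum_option_pmf (μ : PMF (Option S)) : μ none + ∑' y, μ (some y) = 1 := by
  rw [← μ.tsum_coe]
  have := (Equiv.optionEquivSumPUnit.{0} S).symm.tsum_eq (fun y => μ y)
  rw [← this, Summable.tsum_sum ENNReal.summable ENNReal.summable]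
  simp [add_comm]

theorem lt_retTime_iff (A : Set (Option S)) (ω : ℕ → Option S) (n : ℕ) :
    (n : ℕ∞) < retTime A ω ↔ ∀ i, 1 ≤ i → i ≤ n → ω i ∉ A := by
  constructor
  · intro h i h1 hi hA
    have : retTime A ω ≤ (i : ℕ∞) := iInf₂_le i ⟨h1, hA⟩
    exact absurd (h.trans_le this) (by simpa using hi)
  · intro h
    have : ((n + 1 : ℕ) : ℕ∞) ≤ retTime A ω := by
      refine le_iInf₂ fun i hi => ?_
      by_contra! hlt
      exact h i hi.1 (by have := Nat.cast_lt.1 hlt; omega) hi.2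
    exact lt_of_lt_of_le (by exact_mod_cast Nat.lt_succ_self n) this

theorem retTime_union (A B : Set (Option S)) (ω : ℕ → Option S) :
    retTime (A ∪ B) ω = min (retTime A ω) (retTime B ω) := by
  refine le_antisymm (le_min ?_ ?_) (le_iInf₂ fun n hn => ?_)
  · exact le_iInf₂ fun n hn => iInf₂_le n ⟨hn.1, Or.inl hn.2⟩
  · exact le_iInf₂ fun n hn => iInf₂_le n ⟨hn.1, Or.inr hn.2⟩
  · rcases hn.2 with h | h
    · exact min_le_of_left_le (iInf₂_le n ⟨hn.1, h⟩)
    · exact min_le_of_right_le (iInf₂_le n ⟨hn.1, h⟩)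

theorem retTime_eq_of_lt {A : Set (Option S)} {ω : ℕ → Option S} {n : ℕ}
    (h : (n : ℕ∞) < retTime A ω) (hA : ω (n + 1) ∈ A) : retTime A ω = (n + 1 : ℕ) := by
  refine le_antisymm (iInf₂_le (n + 1) ⟨by omega, hA⟩) ?_
  rw [Nat.cast_add, Nat.cast_one]
  exact Order.add_one_le_of_lt h

theorem exists_retTime_eq {A : Set (Option S)} {ω : ℕ → Option S} (h : retTime A ω ≠ ⊤) :
    ∃ n : ℕ, retTime A ω = (n + 1 : ℕ) ∧ ω (n + 1) ∈ A := by
  obtain ⟨m, hm⟩ := ENat.ne_top_iff_exists.1 h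
  have h1 : ¬ (m : ℕ∞) < retTime A ω := by rw [← hm]; exact lt_irrefl _
  rw [lt_retTime_iff] at h1
  push Not at h1
  obtain ⟨i, h1, hi, hA⟩ := h1
  have h2 : retTime A ω ≤ (i : ℕ∞) := iInf₂_le i ⟨h1, hA⟩
  rw [← hm, Nat.cast_le] at h2
  obtain rfl : i = m := le_antisymm hi h2
  obtain ⟨n, rfl⟩ : ∃ n, i = n + 1 := ⟨i - 1, by omega⟩
  exact ⟨n, hm.symm, hA⟩

theorem measurableSet_lt_retTime (A : Set (Option S)) (n : ℕ) :
    MeasurableSet {ω : ℕ → Option S | (n : ℕ∞) < retTime A ω} := by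
  have : {ω : ℕ → Option S | (n : ℕ∞) < retTime A ω} =
      ⋂ i : ℕ, ⋂ _ : 1 ≤ i ∧ i ≤ n, (fun ω : ℕ → Option S => ω i) ⁻¹' Aᶜ := by
    ext ω
    simp only [Set.mem_ofPred_eq, lt_retTime_iff, Set.mem_iInter, Set.mem_preimage,
      Set.mem_compl_iff, and_imp]
  rw [this]
  exact MeasurableSet.iInter fun i => MeasurableSet.iInter fun _ =>
    measurable_pi_apply i (MeasurableSet.of_discrete)

theorem measurableSet_tau_lt_tauAbs (x : S) :
    MeasurableSet {ω : ℕ → Option S | tau x ω < tauAbs ω} := by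
  have : {ω : ℕ → Option S | tau x ω < tauAbs ω} = ⋃ n : ℕ,
      {ω | (n : ℕ∞) < retTime {some x} ω}ᶜ ∩ {ω | (n : ℕ∞) < retTime {none} ω} := by
    ext ω
    simp only [Set.mem_ofPred_eq, Set.mem_iUnion, Set.mem_inter_iff, Set.mem_compl_iff, not_lt]
    constructor
    · intro h
      obtain ⟨n, hn⟩ := ENat.ne_top_iff_exists.1 h.ne_top
      exact ⟨n, hn.symm.le, hn.trans_lt h⟩
    · rintro ⟨n, h1, h2⟩
      exact h1.trans_lt h2
  rw [this]
  exact MeasurableSet.iUnion fun n =>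
    (measurableSet_lt_retTime _ n).compl.inter (measurableSet_lt_retTime _ n)

theorem measurableSet_eval (n : ℕ) (A : Set (Option S)) :
    MeasurableSet {ω : ℕ → Option S | ω n ∈ A} :=
  measurable_pi_apply n (MeasurableSet.of_discrete (s := A))

instance (p : Option S → PMF (Option S)) : IsMarkovKernel (pathKernel p) := by
  unfold pathKernel; infer_instance

instance (p : Option S → PMF (Option S)) (x : S) : IsProbabilityMeasure (PrAt p x) := by
  unfold PrAt; infer_instance

/-- The Markov property at a fixed time. -/
theorem PrAt_markov (p : Option S → PMF (Option S)) (x : S) (A : Set (Option S)) (n : ℕ)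
    (z w : Option S) :
    PrAt p x {ω | ((n : ℕ∞) < retTime A ω ∧ ω n = z) ∧ ω (n + 1) = w} =
      PrAt p x {ω | (n : ℕ∞) < retTime A ω ∧ ω n = z} * p z w := by
  set x₀ : ∀ _ : Finset.Iic 0, Option S := fun _ => some x
  have hP : PrAt p x = Kernel.traj (X := fun _ => Option S) (historyKernel p) 0 x₀ := by
    simp only [PrAt, pathKernel, Kernel.comap_apply]; rfl
  have hmap := Kernel.partialTraj_compProd_eq_map_traj (X := fun _ => Option S)
    (κ := historyKernel p) (Nat.zero_le n) (x₀ := x₀)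
  have hmap2 := Kernel.traj_map_frestrictLe_apply (X := fun _ => Option S)
    (κ := historyKernel p) 0 n x₀
  rw [← hP] at hmap hmap2
  -- The event up to time `n` is a cylinder over histories; on it the last coordinate is `z`, so the
  -- history kernel gives `w` the constant mass `p z w`.
  let B : Set (∀ _ : Finset.Iic n, Option S) :=
    (⋂ i : Finset.Iic n, ⋂ _ : 1 ≤ (i : ℕ),
      (fun h : ∀ _ : Finset.Iic n, Option S => h i) ⁻¹' Aᶜ) ∩
    (fun h : ∀ _ : Finset.Iic n, Option S => h ⟨n, Finset.mem_Iic.2 le_rfl⟩) ⁻¹' {z}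
  have hB : MeasurableSet B := by
    refine MeasurableSet.inter ?_ ?_
    · exact MeasurableSet.iInter fun i => MeasurableSet.iInter fun _ =>
        measurable_pi_apply i (MeasurableSet.of_discrete)
    · exact measurable_pi_apply _ (MeasurableSet.of_discrete)
  have hpre : {ω : ℕ → Option S | (n : ℕ∞) < retTime A ω ∧ ω n = z} =
      Preorder.frestrictLe (π := fun _ => Option S) n ⁻¹' B := by
    ext ω
    simp only [Set.mem_ofPred_eq, lt_retTime_iff, Set.mem_preimage, B, Set.mem_inter_iff,
      Set.mem_iInter, Set.mem_compl_iff, Set.mem_singleton_iff]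
    refine and_congr ⟨fun h i h1 => h i h1 (Finset.mem_Iic.1 i.2), fun h i h1 hi => ?_⟩ Iff.rfl
    exact h ⟨i, Finset.mem_Iic.2 hi⟩ h1
  have hpre2 : {ω : ℕ → Option S | ((n : ℕ∞) < retTime A ω ∧ ω n = z) ∧ ω (n + 1) = w} =
      (fun ω : ℕ → Option S => (Preorder.frestrictLe (π := fun _ => Option S) n ω, ω (n + 1))) ⁻¹'
        (B ×ˢ {w}) := by
    ext ω
    have h1 := congrArg (ω ∈ ·) hpre
    simp only [Set.mem_preimage, Set.mem_ofPred_eq] at h1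
    simp only [Set.mem_preimage, Set.mem_prod, Set.mem_ofPred_eq, Set.mem_singleton_iff, h1]
  have hmeas : Measurable (Preorder.frestrictLe (π := fun _ => Option S) n) := by fun_prop
  rw [hpre2, hpre, ← Measure.map_apply (by fun_prop) (hB.prod (MeasurableSet.of_discrete)),
    ← Measure.map_apply hmeas hB, ← hmap, hmap2,
    Measure.compProd_apply_prod hB MeasurableSet.of_discrete]
  rw [setLIntegral_congr_fun hB (g := fun _ => p z w), setLIntegral_const, mul_comm]
  rintro h ⟨-, hz⟩
  replace hz : h ⟨n, Finset.mem_Iic.2 le_rfl⟩ = z := hz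
  simp only [historyKernel, Kernel.comap_apply, hz]
  exact PMF.toMeasure_apply_singleton _ _ MeasurableSet.of_discrete

theorem PrAt_zero (p : Option S → PMF (Option S)) (x : S) (z : Option S) [Decidable (z = some x)] :
    PrAt p x {ω | ω 0 = z} = if z = some x then 1 else 0 := by
  set x₀ : ∀ _ : Finset.Iic 0, Option S := fun _ => some x with hx₀
  have hP : PrAt p x = Kernel.traj (X := fun _ => Option S) (historyKernel p) 0 x₀ := by
    simp only [PrAt, pathKernel, Kernel.comap_apply]; rfl
  have hmap := Kernel.traj_map_frestrictLe_apply (X := fun _ => Option S)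
    (κ := historyKernel p) 0 0 x₀
  rw [← hP, Kernel.partialTraj_self, Kernel.id_apply] at hmap
  let B : Set (∀ _ : Finset.Iic 0, Option S) :=
    (fun h => h ⟨0, Finset.mem_Iic.2 le_rfl⟩) ⁻¹' {z}
  have hB : MeasurableSet B := measurable_pi_apply _ (MeasurableSet.of_discrete)
  have hpre : {ω : ℕ → Option S | ω 0 = z} =
    Preorder.frestrictLe (π := fun _ => Option S) 0 ⁻¹' B := rfl
  have hmeas : Measurable (Preorder.frestrictLe (π := fun _ => Option S) 0) := by fun_prop
  rw [hpre, ← Measure.map_apply hmeas hB, hmap, Measure.dirac_apply' _ hB]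
  by_cases h : z = some x
  · simp [B, hx₀, h]
  · simp [B, hx₀, h, eq_comm]

theorem tsum_option_eq (f : Option S → ℝ≥0∞) (h : f none = 0) :
    ∑' z, f z = ∑' z, f (some z) := by
  refine ((Option.some_injective S).tsum_eq fun z hz => ?_).symm
  cases z with
  | none => exact absurd h hz
  | some z => exact ⟨z, rfl⟩

theorem preimage_none_union (K : Set S) : some ⁻¹' ({none} ∪ some '' K : Set (Option S)) = K := by
  ext x; simp

theorem min_tauAbs_tau (x : S) (ω : ℕ → Option S) :
    min (tauAbs ω) (tau x ω) = retTime ({none} ∪ some '' {x}) ω := by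
  rw [retTime_union, Set.image_singleton]; rfl

theorem min_tauAbs_tauSet (K : Set S) (ω : ℕ → Option S) :
    min (tauAbs ω) (tauSet K ω) = retTime ({none} ∪ some '' K) ω := by
  rw [retTime_union]; rfl

theorem PrAt_lt_retTime_none (p : Option S → PMF (Option S)) (x : S) {A : Set (Option S)}
    (hA : none ∈ A) (n : ℕ) : PrAt p x {ω | (n : ℕ∞) < retTime A ω ∧ ω n = none} = 0 := by
  classical
  rcases Nat.eq_zero_or_pos n with rfl | hn
  · refine measure_mono_null (t := {ω | ω 0 = none}) (fun ω h => h.2) ?_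
    simp [PrAt_zero]
  · refine measure_mono_null (t := ∅) (fun ω h => ?_) measure_empty
    exact (lt_retTime_iff _ _ _).1 h.1 n hn le_rfl (h.2 ▸ hA)

theorem tauAbs_lt_tau_iff (x : S) (ω : ℕ → Option S) :
    tauAbs ω < tau x ω ↔
      ∃ n : ℕ, (n : ℕ∞) < retTime ({none} ∪ some '' {x}) ω ∧ ω (n + 1) = none := by
  rw [← min_tauAbs_tau]
  constructor
  · intro h
    obtain ⟨n, hn, h0⟩ := exists_retTime_eq (A := {none}) (ω := ω) h.ne_top
    refine ⟨n, ?_, h0⟩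
    rw [min_eq_left h.le, tauAbs, hn]
    exact_mod_cast Nat.lt_succ_self n
  · rintro ⟨n, hn, h0⟩
    rw [lt_min_iff] at hn
    have h1 : tauAbs ω = (n + 1 : ℕ) := retTime_eq_of_lt hn.1 h0
    rw [h1, tau, lt_retTime_iff]
    intro i h1 hi
    rcases Nat.lt_or_ge n i with h2 | h2
    · obtain rfl : i = n + 1 := by omega
      simp [h0]
    · exact (lt_retTime_iff _ _ _).1 hn.2 i h1 h2

theorem exists_of_tau_lt_tauAbs {x : S} {ω : ℕ → Option S} (h : tau x ω < tauAbs ω) :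
    ∃ n : ℕ, (n : ℕ∞) < retTime ({none} ∪ some '' {x}) ω ∧ ω (n + 1) = some x := by
  rw [← min_tauAbs_tau]
  obtain ⟨n, hn, h0⟩ := exists_retTime_eq (A := {some x}) (ω := ω) h.ne_top
  refine ⟨n, ?_, h0⟩
  rw [min_eq_right h.le, tau, hn]
  exact_mod_cast Nat.lt_succ_self n

variable [Countable S]

theorem measure_eq_tsum_eval (ν : Measure (ℕ → Option S)) {E : Set (ℕ → Option S)}
    (hE : MeasurableSet E) (n : ℕ) : ν E = ∑' z, ν (E ∩ {ω | ω n = z}) := by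
  rw [← measure_iUnion]
  · congr 1; ext ω; simp
  · intro a b hab
    refine Set.disjoint_left.2 fun ω h1 h2 => hab (h1.2.symm.trans h2.2)
  · exact fun z => hE.inter (measurableSet_eval n {z})

/-- The law of the killed chain. -/
theorem PrAt_lt_retTime_eval (p : Option S → PMF (Option S)) (x : S) {A : Set (Option S)}
    (hA : none ∈ A) (n : ℕ) (y : S) :
    PrAt p x {ω | (n : ℕ∞) < retTime A ω ∧ ω n = some y} =
      kpow (tab (some ⁻¹' A) (onS p)) n x y := by
  classical
  induction n generalizing y with
  | zero =>
    have : {ω : ℕ → Option S | ((0 : ℕ) : ℕ∞) < retTime A ω ∧ ω 0 = some y} =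
        {ω | ω 0 = some y} := by
      ext ω
      simp only [Set.mem_ofPred_eq, lt_retTime_iff, and_iff_right_iff_imp]
      intro _ i h1 h2; omega
    rw [this, PrAt_zero]
    simp [kpow, pt, eq_comm]
  | succ n ih =>
    by_cases hy : some y ∈ A
    · have : {ω : ℕ → Option S | ((n + 1 : ℕ) : ℕ∞) < retTime A ω ∧ ω (n + 1) = some y} = ∅ := by
        ext ω
        simp only [Set.mem_ofPred_eq, lt_retTime_iff, Set.mem_empty_iff_false, iff_false, not_and]
        intro h h0
        exact h (n + 1) (by omega) le_rfl (h0 ▸ hy)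
      rw [this, measure_empty, kpow]
      simp [tab, hy]
    · have : {ω : ℕ → Option S | ((n + 1 : ℕ) : ℕ∞) < retTime A ω ∧ ω (n + 1) = some y} =
          {ω | (n : ℕ∞) < retTime A ω ∧ ω (n + 1) = some y} := by
        ext ω
        simp only [Set.mem_ofPred_eq, lt_retTime_iff]
        refine and_congr_left fun h0 => ⟨fun h i h1 hi => h i h1 (by omega), fun h i h1 hi => ?_⟩
        rcases Nat.lt_or_ge n i with h2 | h2
        · obtain rfl : i = n + 1 := by omega
          rw [h0]; exact hy
        · exact h i h1 h2
      have hm : MeasurableSet {ω : ℕ → Option S | (n : ℕ∞) < retTime A ω ∧ ω (n + 1) = some y} :=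
        (measurableSet_lt_retTime A n).inter (measurableSet_eval (n + 1) {some y})
      rw [this, measure_eq_tsum_eval _ hm n]
      have e : ∀ z, {ω : ℕ → Option S | (n : ℕ∞) < retTime A ω ∧ ω (n + 1) = some y} ∩
          {ω | ω n = z} = {ω | ((n : ℕ∞) < retTime A ω ∧ ω n = z) ∧ ω (n + 1) = some y} := by
        intro z; ext ω; simp only [Set.mem_inter_iff, Set.mem_ofPred_eq]; tauto
      simp only [e, PrAt_markov]
      rw [tsum_option_eq _ (by rw [PrAt_lt_retTime_none p x hA, zero_mul]), kpow]
      exact tsum_congr fun z => by rw [ih]; simp [tab, hy, onS]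

/-- The law of the exit position of the killed chain. -/
theorem PrAt_exit (p : Option S → PMF (Option S)) (x : S) {A : Set (Option S)}
    (hA : none ∈ A) (n : ℕ) (w : Option S) :
    PrAt p x {ω | (n : ℕ∞) < retTime A ω ∧ ω (n + 1) = w} =
      ∑' z, kpow (tab (some ⁻¹' A) (onS p)) n x z * p (some z) w := by
  have hm : MeasurableSet {ω : ℕ → Option S | (n : ℕ∞) < retTime A ω ∧ ω (n + 1) = w} :=
    (measurableSet_lt_retTime A n).inter (measurableSet_eval (n + 1) {w})
  rw [measure_eq_tsum_eval _ hm n]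
  have e : ∀ z, {ω : ℕ → Option S | (n : ℕ∞) < retTime A ω ∧ ω (n + 1) = w} ∩
      {ω | ω n = z} = {ω | ((n : ℕ∞) < retTime A ω ∧ ω n = z) ∧ ω (n + 1) = w} := by
    intro z; ext ω; simp only [Set.mem_inter_iff, Set.mem_ofPred_eq]; tauto
  simp only [e, PrAt_markov]
  rw [tsum_option_eq _ (by rw [PrAt_lt_retTime_none p x hA, zero_mul])]
  exact tsum_congr fun z => by rw [PrAt_lt_retTime_eval p x hA]

theorem PrAt_lt_retTime_mem (p : Option S → PMF (Option S)) (x : S) {A : Set (Option S)}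
    (hA : none ∈ A) (n : ℕ) (B : Set S) :
    PrAt p x {ω | (n : ℕ∞) < retTime A ω ∧ ω n ∈ some '' B} =
      (app (tab (some ⁻¹' A) (onS p)))^[n] (B.indicator 1) x := by
  have hm : MeasurableSet {ω : ℕ → Option S | (n : ℕ∞) < retTime A ω ∧ ω n ∈ some '' B} :=
    (measurableSet_lt_retTime A n).inter (measurableSet_eval n (some '' B))
  rw [measure_eq_tsum_eval _ hm n, tsum_option_eq, app_iterate]
  · refine tsum_congr fun y => ?_
    rw [← PrAt_lt_retTime_eval p x hA]
    by_cases hy : y ∈ B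
    · simp only [Set.indicator_of_mem hy, Pi.one_apply, mul_one]
      congr 1; ext ω
      simp only [Set.mem_inter_iff, Set.mem_ofPred_eq]
      exact ⟨fun h => ⟨h.1.1, h.2⟩, fun h => ⟨⟨h.1, ⟨y, hy, h.2.symm⟩⟩, h.2⟩⟩
    · simp only [Set.indicator_of_notMem hy, mul_zero]
      refine measure_mono_null (t := ∅) ?_ measure_empty
      rintro ω ⟨⟨-, y', hy', h1⟩, h2 : ω n = some y⟩
      rw [h2, Option.some_inj] at h1
      exact hy (h1 ▸ hy')
  · refine measure_mono_null (fun ω h => ?_) (PrAt_lt_retTime_none p x hA n)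
    exact ⟨h.1.1, h.2⟩

theorem PrAt_lt_retTime (p : Option S → PMF (Option S)) (x : S) {A : Set (Option S)}
    (hA : none ∈ A) (n : ℕ) :
    PrAt p x {ω | (n : ℕ∞) < retTime A ω} = (app (tab (some ⁻¹' A) (onS p)))^[n] 1 x := by
  rw [measure_eq_tsum_eval _ (measurableSet_lt_retTime A n) n, tsum_option_eq, app_iterate]
  · refine tsum_congr fun y => ?_
    rw [← PrAt_lt_retTime_eval p x hA]
    simp [Set.ofPred_and]
  · exact PrAt_lt_retTime_none p x hA n

theorem Pr_apply (p : Option S → PMF (Option S)) (μ : PMF S) {E : Set (ℕ → Option S)}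
    (hE : MeasurableSet E) : Pr p μ E = ∑' x, μ x * PrAt p x E := by
  rw [Pr, Measure.bind_apply hE (pathKernel p).measurable.aemeasurable, lintegral_countable',
    tsum_option_eq]
  · refine tsum_congr fun x => ?_
    rw [PMF.toMeasure_apply_singleton _ _ MeasurableSet.of_discrete, mul_comm]
    congr 1
    rw [PMF.map_apply, tsum_eq_single x]
    · simp
    · intro y hy; simp [hy.symm]
  · rw [PMF.toMeasure_apply_singleton _ _ MeasurableSet.of_discrete, PMF.map_apply]
    simp

end Paths

/-! ### Exponential moments as potentials. -/

section Exponential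

theorem ofReal_exp_natCast (l : ℝ) (n : ℕ) :
    ENNReal.ofReal (Real.exp (l * n)) = ENNReal.ofReal (Real.exp l) ^ n := by
  rw [← ENNReal.ofReal_pow (Real.exp_pos l).le, ← Real.exp_nat_mul, mul_comm]

theorem expTime_natCast (l : ℝ) (n : ℕ) : expTime l n = ENNReal.ofReal (Real.exp l) ^ n := by
  rw [← ofReal_exp_natCast]; simp [expTime]

theorem one_lt_ofReal_exp {l : ℝ} (hl : 0 < l) : 1 < ENNReal.ofReal (Real.exp l) := by
  rw [ENNReal.one_lt_ofReal]; exact Real.one_lt_exp_iff.2 hl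

/-- A finite geometric sum, replacing the exponential by tail indicators. At `⊤` both sides are
infinite because `l > 0`. -/
theorem expTime_eq_tsum {l : ℝ} (hl : 0 < l) (t : ℕ∞) :
    expTime l t = 1 + (ENNReal.ofReal (Real.exp l) - 1) *
      ∑' n : ℕ, if (n : ℕ∞) < t then ENNReal.ofReal (Real.exp l) ^ n else 0 := by
  set r := ENNReal.ofReal (Real.exp l) with hr
  have h1 : 1 < r := one_lt_ofReal_exp hl
  induction t using ENat.recTopCoe with
  | top =>
    have : ∑' n : ℕ, (if (n : ℕ∞) < ⊤ then r ^ n else 0) = ⊤ := by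
      simp only [ENat.natCast_lt_top, if_true]
      rw [ENNReal.tsum_geometric, tsub_eq_zero_of_le h1.le, ENNReal.inv_zero]
    rw [this, ENNReal.mul_top (tsub_pos_of_lt h1).ne']
    simp [expTime]
  | coe k =>
    rw [expTime_natCast, ← hr, tsum_eq_sum (s := Finset.range k)
      (fun n hn => by simp at hn; simp [hn])]
    rw [Finset.sum_congr rfl (g := fun n => r ^ n)
      (fun n hn => by simp at hn; simp [hn])]
    induction k with
    | zero => simp
    | succ k ih =>
      rw [Finset.sum_range_succ, mul_add, ← add_assoc, ← ih, pow_succ']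
      conv_lhs => rw [← add_tsub_cancel_of_le h1.le, add_mul, one_mul, add_tsub_cancel_of_le h1.le]

variable {S : Type*} [Countable S]

theorem lintegral_expTime (p : Option S → PMF (Option S)) (x : S) {A : Set (Option S)}
    (hA : none ∈ A) {l : ℝ} (hl : 0 < l) :
    ∫⁻ ω, expTime l (retTime A ω) ∂(PrAt p x) = 1 + (ENNReal.ofReal (Real.exp l) - 1) *
      pot (tab (some ⁻¹' A) (fun a b => ENNReal.ofReal (Real.exp l) * onS p a b)) 1 x := by
  set r := ENNReal.ofReal (Real.exp l) with hr
  have hmeas : ∀ n : ℕ, Measurable fun ω : ℕ → Option S =>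
      if (n : ℕ∞) < retTime A ω then r ^ n else 0 := fun n =>
    Measurable.ite (measurableSet_lt_retTime A n) measurable_const measurable_const
  simp only [expTime_eq_tsum hl, ← hr]
  rw [lintegral_add_left measurable_const, lintegral_const, measure_univ, one_mul,
    lintegral_const_mul _ (Measurable.tsum hmeas),
    lintegral_tsum fun n => (hmeas n).aemeasurable]
  congr 2
  refine tsum_congr fun n => ?_
  have : (fun ω : ℕ → Option S => if (n : ℕ∞) < retTime A ω then r ^ n else 0) =
      Set.indicator {ω | (n : ℕ∞) < retTime A ω} fun _ => r ^ n := by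
    funext ω; simp [Set.indicator_apply]
  rw [this, lintegral_indicator_const (measurableSet_lt_retTime A n), PrAt_lt_retTime p x hA,
    tab_const_mul, app_iterate, app_iterate, ← ENNReal.tsum_mul_left]
  exact tsum_congr fun y => by rw [kpow_const_mul]; simp

theorem absMGF_eq (p : Option S → PMF (Option S)) (x : S) {l : ℝ} (hl : 0 < l) :
    absMGF p l x = 1 + (ENNReal.ofReal (Real.exp l) - 1) *
      pot (fun a b => ENNReal.ofReal (Real.exp l) * onS p a b) 1 x := by
  rw [absMGF]
  simp only [tauAbs]
  rw [lintegral_expTime p x (A := {none}) rfl hl]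
  congr 3
  funext a b; simp [tab]

theorem absMGF_eq_top_iff (p : Option S → PMF (Option S)) (x : S) {l : ℝ} (hl : 0 < l) :
    absMGF p l x = ⊤ ↔ pot (fun a b => ENNReal.ofReal (Real.exp l) * onS p a b) 1 x = ⊤ := by
  have h := (tsub_pos_of_lt (one_lt_ofReal_exp hl)).ne'
  rw [absMGF_eq p x hl]
  simp [ENNReal.mul_eq_top, h]

theorem lintegral_expTime_lt_top_iff (p : Option S → PMF (Option S)) (x : S) {A : Set (Option S)}
    (hA : none ∈ A) {l : ℝ} (hl : 0 < l) :
    ∫⁻ ω, expTime l (retTime A ω) ∂(PrAt p x) < ⊤ ↔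
      pot (tab (some ⁻¹' A) (fun a b => ENNReal.ofReal (Real.exp l) * onS p a b)) 1 x < ⊤ := by
  have h := (tsub_pos_of_lt (one_lt_ofReal_exp hl)).ne'
  rw [lintegral_expTime p x hA hl, lt_top_iff_ne_top, lt_top_iff_ne_top]
  simp [ENNReal.mul_eq_top, h]

theorem PrAt_tau_lt_tauAbs_le (p : Option S → PMF (Option S)) (x y : S) :
    PrAt p y {ω | tau x ω < tauAbs ω} ≤ hit (onS p) x y := by
  calc PrAt p y {ω | tau x ω < tauAbs ω} ≤
      PrAt p y (⋃ n : ℕ, {ω | (n : ℕ∞) < retTime ({none} ∪ some '' {x}) ω ∧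
        ω (n + 1) = some x}) := by
        refine measure_mono fun ω h => ?_
        obtain ⟨n, hn⟩ := exists_of_tau_lt_tauAbs h
        exact Set.mem_iUnion.2 ⟨n, hn⟩
    _ ≤ ∑' n : ℕ, PrAt p y {ω | (n : ℕ∞) < retTime ({none} ∪ some '' {x}) ω ∧
        ω (n + 1) = some x} := measure_iUnion_le _
    _ = hit (onS p) x y := by
      refine tsum_congr fun n => ?_
      rw [PrAt_exit p y (Or.inl rfl), preimage_none_union, app_iterate]
      rfl

/-- The event splits according to the value n + 1 of the absorption time; the factor outside the
potential accounts for the last step, into Δ. -/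
theorem setLIntegral_expTime_tauAbs (p : Option S → PMF (Option S)) (x : S) (l : ℝ) :
    ∫⁻ ω in {ω | tauAbs ω < tau x ω}, expTime l (tauAbs ω) ∂(PrAt p x) =
      ENNReal.ofReal (Real.exp l) *
        pot (tab {x} (fun a b => ENNReal.ofReal (Real.exp l) * onS p a b))
          (fun z => p (some z) none) x := by
  set r := ENNReal.ofReal (Real.exp l) with hr
  let E : ℕ → Set (ℕ → Option S) := fun n =>
    {ω | (n : ℕ∞) < retTime ({none} ∪ some '' {x}) ω ∧ ω (n + 1) = none}
  have hE : {ω : ℕ → Option S | tauAbs ω < tau x ω} = ⋃ n, E n := by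
    ext ω
    simp only [Set.mem_ofPred_eq, Set.mem_iUnion, E]
    exact tauAbs_lt_tau_iff x ω
  have hτ : ∀ n, ∀ ω ∈ E n, tauAbs ω = (n + 1 : ℕ) := by
    rintro n ω ⟨h1, h2⟩
    rw [← min_tauAbs_tau] at h1
    exact retTime_eq_of_lt (lt_min_iff.1 h1).1 h2
  have hm : ∀ n, MeasurableSet (E n) := fun n =>
    (measurableSet_lt_retTime _ n).inter (measurableSet_eval (n + 1) {none})
  rw [hE, lintegral_iUnion hm]
  · rw [pot, ← ENNReal.tsum_mul_left]
    refine tsum_congr fun n => ?_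
    rw [setLIntegral_congr_fun (hm n) (g := fun _ => r ^ (n + 1))
      (fun ω hω => by rw [hτ n ω hω, expTime_natCast]), setLIntegral_const,
      PrAt_exit p x (Or.inl rfl), preimage_none_union, tab_const_mul, app_iterate, pow_succ',
      mul_assoc, ← ENNReal.tsum_mul_left]
    congr 1
    exact tsum_congr fun y => by rw [kpow_const_mul]; ring
  · intro a b hab
    refine Set.disjoint_left.2 fun ω h1 h2 => hab ?_
    have := (hτ a ω h1).symm.trans (hτ b ω h2)
    have := Nat.cast_injective (R := ℕ∞) this
    omega

/-- This is u ≤ e^u with u = (l₂ - l₁)t: a slightly larger exponent absorbs the factor `t`. -/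
theorem expTime_mul_le {l₁ l₂ : ℝ} (h : l₁ < l₂) (t : ℕ∞) :
    expTime l₁ t * (t : ℝ≥0∞) ≤ ENNReal.ofReal (l₂ - l₁)⁻¹ * expTime l₂ t := by
  have hpos : 0 < l₂ - l₁ := sub_pos.2 h
  induction t using ENat.recTopCoe with
  | top =>
    have : expTime l₂ ⊤ = ⊤ := by simp [expTime]
    rw [this, ENNReal.mul_top (by simpa using h)]
    exact le_top
  | coe k =>
    have e : ∀ l : ℝ, expTime l (k : ℕ∞) = ENNReal.ofReal (Real.exp (l * k)) := fun l => by
      rw [expTime_natCast, ofReal_exp_natCast]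
    have hk : (((k : ℕ∞) : ℝ≥0∞)) = ENNReal.ofReal (k : ℝ) := by simp
    rw [e, e, hk, ← ENNReal.ofReal_mul (Real.exp_pos _).le,
      ← ENNReal.ofReal_mul (inv_pos.2 hpos).le]
    refine ENNReal.ofReal_le_ofReal ?_
    have h1 : (l₂ - l₁) * k ≤ Real.exp ((l₂ - l₁) * k) :=
      (le_add_of_nonneg_right zero_le_one).trans (Real.add_one_le_exp _)
    have h2 : Real.exp (l₂ * k) = Real.exp (l₁ * k) * Real.exp ((l₂ - l₁) * k) := by
      rw [← Real.exp_add]; ring_nf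
    rw [h2]
    calc Real.exp (l₁ * k) * k = (l₂ - l₁)⁻¹ * (Real.exp (l₁ * k) * ((l₂ - l₁) * k)) := by
          field_simp
      _ ≤ _ := by gcongr

end Exponential

/-! ### Convergence of aperiodic positive recurrent chains; the Doob transform. -/

section Ergodic

variable {S : Type*}

theorem summable_tsum_mul {M : S → S → ℝ} (hM : ∀ x y, 0 ≤ M x y) (hM1 : ∀ x, HasSum (M x) 1)
    {d : S → ℝ} (hd0 : ∀ x, 0 ≤ d x) (hd : Summable d) :
    (∀ y, Summable fun z => d z * M z y) ∧ HasSum (fun y => ∑' z, d z * M z y) (∑' z, d z) := by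
  have hprod : Summable fun a : S × S => d a.1 * M a.1 a.2 := by
    have h0 : 0 ≤ fun a : S × S => d a.1 * M a.1 a.2 := fun a =>
      mul_nonneg (hd0 a.1) (hM a.1 a.2)
    have h1 : ∀ x, Summable fun y => d x * M x y := fun x => (hM1 x).summable.mul_left (d x)
    have h2 : ∀ x, ∑' y, d x * M x y = d x := fun x => by
      rw [tsum_mul_left, (hM1 x).tsum_eq, mul_one]
    refine (summable_prod_of_nonneg h0).2 ⟨h1, ?_⟩
    exact (summable_congr h2).2 hd
  have hswap : Summable fun a : S × S => d a.2 * M a.2 a.1 :=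
    (Equiv.prodComm S S).summable_iff.2 hprod
  refine ⟨fun y => hswap.prod_factor y, ?_⟩
  have h1 : Summable fun y => ∑' z, d z * M z y := hswap.prod
  convert h1.hasSum using 1
  rw [← Summable.tsum_comm (f := fun y z => d z * M z y) hswap]
  exact tsum_congr fun x => by rw [tsum_mul_left, (hM1 x).tsum_eq, mul_one]

/-- A stochastic matrix that does not decrease the `ℓ¹` norm of `η` does not merge positive and
negative parts of `η`. -/
theorem not_pos_neg_of_norm_eq {M : S → S → ℝ} (hM : ∀ x y, 0 ≤ M x y)
    (hM1 : ∀ x, HasSum (M x) 1) {η : S → ℝ} (hη : Summable η)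
    (heq : ∑' y, |∑' z, η z * M z y| = ∑' z, |η z|) {a b y : S} (ha : 0 < η a) (hb : η b < 0)
    (hay : 0 < M a y) (hby : 0 < M b y) : False := by
  obtain ⟨hs, hsum⟩ := summable_tsum_mul hM hM1 (fun z => abs_nonneg (η z)) hη.abs
  have habs : ∀ y z, |η z * M z y| = |η z| * M z y := fun y z => by
    rw [abs_mul, abs_of_nonneg (hM z y)]
  have hs' : ∀ y, Summable fun z => η z * M z y := fun y =>
    Summable.of_abs (by simpa only [habs] using hs y)
  have hle : ∀ y, |∑' z, η z * M z y| ≤ ∑' z, |η z| * M z y := fun y => by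
    have := norm_tsum_le_tsum_norm (f := fun z => η z * M z y)
      (by simpa only [Real.norm_eq_abs, habs] using hs y)
    simpa only [Real.norm_eq_abs, habs] using this
  have hsA : Summable fun y => |∑' z, η z * M z y| :=
    Summable.of_nonneg_of_le (fun y => abs_nonneg _) hle hsum.summable
  -- The triangle inequality holds in every column and the totals agree, so it is an equality in
  -- each column.
  have hy : |∑' z, η z * M z y| = ∑' z, |η z| * M z y := by
    by_contra hne
    have := Summable.tsum_lt_tsum hle (lt_of_le_of_ne (hle y) hne) hsA hsum.summable
    rw [heq, hsum.tsum_eq] at this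
    exact lt_irrefl _ this
  rcases le_total 0 (∑' z, η z * M z y) with h0 | h0
  · rw [abs_of_nonneg h0] at hy
    have := Summable.tsum_lt_tsum (f := fun z => η z * M z y) (g := fun z => |η z| * M z y) (i := b)
      (fun z => mul_le_mul_of_nonneg_right (le_abs_self _) (hM z y))
      (mul_lt_mul_of_pos_right (hb.trans (abs_pos.2 hb.ne)) hby) (hs' y) (hs y)
    exact this.ne hy
  · rw [abs_of_nonpos h0, ← tsum_neg] at hy
    have := Summable.tsum_lt_tsum (f := fun z => -(η z * M z y)) (g := fun z => |η z| * M z y)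
      (i := a) (fun z => by
        change -(η z * M z y) ≤ |η z| * M z y
        rw [← neg_mul]; exact mul_le_mul_of_nonneg_right (neg_le_abs _) (hM z y))
      (by rw [← neg_mul]
          exact mul_lt_mul_of_pos_right ((neg_neg_of_pos ha).trans (abs_pos.2 ha.ne')) hay)
      (hs' y).neg (hs y)
    exact this.ne hy

theorem tsum_kpow_eq_one {P : S → S → ℝ≥0∞} (hrow : ∀ x, ∑' y, P x y = 1) (n : ℕ) (x : S) :
    ∑' y, kpow P n x y = 1 := by
  have h := iterate_eq_of_harmonic (q := P) (h := fun _ => 1) (fun x => by simp [app, hrow]) n x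
  simpa [app_iterate] using h

/-- Convergence in total variation of an aperiodic positive recurrent Markov chain. -/
theorem tendsto_tsum_abs_sub {P : S → S → ℝ≥0∞} (hrow : ∀ x, ∑' y, P x y = 1) {π : S → ℝ≥0∞}
    (hπ1 : ∑' y, π y = 1) (hinv : ∀ y, ∑' z, π z * P z y = π y)
    (hmix : ∀ a b, ∃ k z, kpow P k a z ≠ 0 ∧ kpow P k b z ≠ 0) {x : S} (hx : π x ≠ 0) :
    Tendsto (fun n => ∑' y, |(kpow P n x y).toReal - (π y).toReal|) atTop (𝓝 0) := by
  have hk1 : ∀ n x y, kpow P n x y ≤ 1 := fun n x y => by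
    rw [← tsum_kpow_eq_one hrow n x]; exact ENNReal.le_tsum y
  have hkt : ∀ n x y, kpow P n x y ≠ ⊤ := fun n x y => ne_top_of_le_ne_top (by simp) (hk1 n x y)
  have hπt : ∀ y, π y ≠ ⊤ := fun y => ne_top_of_le_ne_top (b := 1) (by simp)
    (by rw [← hπ1]; exact ENNReal.le_tsum y)
  let M : ℕ → S → S → ℝ := fun k z y => (kpow P k z y).toReal
  let w : S → ℝ := fun y => (π y).toReal
  have hM0 : ∀ k z y, 0 ≤ M k z y := fun _ _ _ => ENNReal.toReal_nonneg
  have hw0 : ∀ y, 0 ≤ w y := fun _ => ENNReal.toReal_nonneg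
  have hM1 : ∀ k z, HasSum (M k z) 1 := fun k z => by
    have h := tsum_kpow_eq_one hrow k z
    have := ENNReal.hasSum_toReal (f := fun y => kpow P k z y) (by rw [h]; simp)
    rwa [← ENNReal.tsum_toReal_eq (hkt k z), h, ENNReal.toReal_one] at this
  have hw1 : HasSum w 1 := by
    have := ENNReal.hasSum_toReal (f := π) (by rw [hπ1]; simp)
    rwa [← ENNReal.tsum_toReal_eq hπt, hπ1, ENNReal.toReal_one] at this
  have hMadd : ∀ n k y, M (n + k) x y = ∑' z, M n x z * M k z y := fun n k y => by
    simp only [M, kpow_add]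
    rw [ENNReal.tsum_toReal_eq fun z => ENNReal.mul_ne_top (hkt n x z) (hkt k z y)]
    simp only [ENNReal.toReal_mul]
  have hinvk : ∀ k y, ∑' z, π z * kpow P k z y = π y := fun k y => by
    simpa using tsum_mul_kpow_of_invariant (c := 1) (by simpa using hinv) k y
  have hwinv : ∀ k y, w y = ∑' z, w z * M k z y := fun k y => by
    simp only [w, M]
    rw [← hinvk k y, ENNReal.tsum_toReal_eq fun z => ENNReal.mul_ne_top (hπt z) (hkt k z y)]
    simp only [ENNReal.toReal_mul]
  have hwx : 0 < w x := ENNReal.toReal_pos hx (hπt x)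
  -- Since π(x) P^n(x, y) ≤ π(y), all the laws are dominated by one multiple of π; this domination
  -- justifies every exchange of limit and sum below.
  have hMw : ∀ n y, M n x y ≤ (w x)⁻¹ * w y := fun n y => by
    rw [inv_mul_eq_div, le_div_iff₀ hwx, mul_comm, ← ENNReal.toReal_mul]
    refine ENNReal.toReal_mono (hπt y) ?_
    rw [← hinvk n y]; exact ENNReal.le_tsum (f := fun z => π z * kpow P n z y) x
  let d : ℕ → S → ℝ := fun n y => M n x y - w y
  have hds : ∀ n, HasSum (d n) 0 := fun n => by simpa using (hM1 n x).sub hw1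
  set B := (w x)⁻¹ + 1 with hB
  have hdB : ∀ n y, |d n y| ≤ B * w y := fun n y => by
    rw [hB, add_mul, one_mul]
    refine (abs_sub _ _).trans ?_
    rw [abs_of_nonneg (hM0 n x y), abs_of_nonneg (hw0 y)]
    exact add_le_add (hMw n y) le_rfl
  have hBs : Summable fun y => B * w y := hw1.summable.mul_left B
  have hsM : ∀ n k y, Summable fun z => M n x z * M k z y := fun n k y =>
    (summable_tsum_mul (hM0 k) (hM1 k) (hM0 n x) (hM1 n x).summable).1 y
  have hsw : ∀ k y, Summable fun z => w z * M k z y := fun k y =>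
    (summable_tsum_mul (hM0 k) (hM1 k) hw0 hw1.summable).1 y
  have hdadd : ∀ n k y, d (n + k) y = ∑' z, d n z * M k z y := fun n k y => by
    simp only [d, sub_mul]
    rw [Summable.tsum_sub (hsM n k y) (hsw k y), ← hMadd, ← hwinv]
  let N : ℕ → ℝ := fun n => ∑' y, |d n y|
  have hN : Antitone N := by
    refine antitone_nat_of_succ_le fun n => ?_
    obtain ⟨h1, h2⟩ := summable_tsum_mul (hM0 1) (hM1 1) (fun z => abs_nonneg (d n z))
      (hds n).summable.abs
    have habs : ∀ y z, ‖d n z * M 1 z y‖ = |d n z| * M 1 z y := fun y z => by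
      rw [Real.norm_eq_abs, abs_mul, abs_of_nonneg (hM0 1 z y)]
    refine (Summable.tsum_le_tsum (fun y => ?_) (hds (n + 1)).summable.abs h2.summable).trans
      h2.tsum_eq.le
    rw [hdadd n 1 y, ← Real.norm_eq_abs]
    have := norm_tsum_le_tsum_norm (f := fun z => d n z * M 1 z y)
      (by simpa only [habs] using h1 y)
    simpa only [habs] using this
  have hlim : Tendsto N atTop (𝓝 (⨅ n, N n)) :=
    tendsto_atTop_ciInf hN ⟨0, by rintro _ ⟨n, rfl⟩; exact tsum_nonneg fun y => abs_nonneg _⟩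
  set D := ⨅ n, N n with hD
  suffices h : D = 0 by rw [← h]; exact hlim
  -- The norms decrease to `D`. A pointwise limit η of the differences along an ultrafilter has norm
  -- `D`, and so do all its images ηP^k, being limits of the shifted differences.
  let U : Ultrafilter ℕ := hyperfilter ℕ
  have hU : (U : Filter ℕ) ≤ atTop := Nat.hyperfilter_le_atTop
  have hη : ∀ y, ∃ e, Tendsto (fun n => d n y) U (𝓝 e) := fun y => by
    obtain ⟨e, -, he⟩ := (isCompact_Icc (a := -(B * w y)) (b := B * w y)).ultrafilter_le_nhds
      (U.map fun n => d n y) (by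
        rw [Ultrafilter.coe_map, le_principal_iff, mem_map]
        exact univ_mem' fun n => abs_le.1 (hdB n y))
    exact ⟨e, he⟩
  choose η hη using hη
  have hηB : ∀ y, |η y| ≤ B * w y := fun y =>
    le_of_tendsto (hη y).abs (Eventually.of_forall fun n => hdB n y)
  have hηs : Summable η := Summable.of_norm_bounded hBs hηB
  have hB0 : 0 ≤ B := by positivity
  have hηk : ∀ k y, Tendsto (fun n => d (n + k) y) U (𝓝 (∑' z, η z * M k z y)) := fun k y => by
    simp only [hdadd]
    refine tendsto_tsum_of_dominated_convergence (bound := fun z => B * (w z * M k z y))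
      ((hsw k y).mul_left B) (fun z => (hη z).mul_const _) (Eventually.of_forall fun n z => ?_)
    rw [Real.norm_eq_abs, abs_mul, abs_of_nonneg (hM0 k z y), ← mul_assoc]
    exact mul_le_mul_of_nonneg_right (hdB n z) (hM0 k z y)
  have hDk : ∀ k, ∑' y, |∑' z, η z * M k z y| = D := fun k => by
    have h1 : Tendsto (fun n => N (n + k)) U (𝓝 D) :=
      ((tendsto_add_atTop_iff_nat k).2 hlim).mono_left hU
    have h2 : Tendsto (fun n => N (n + k)) U (𝓝 (∑' y, |∑' z, η z * M k z y|)) :=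
      tendsto_tsum_of_dominated_convergence hBs (fun y => (hηk k y).abs)
        (Eventually.of_forall fun n y => by simpa using hdB (n + k) y)
    exact tendsto_nhds_unique h2 h1
  have hDη : ∑' y, |η y| = D := by
    have h1 : Tendsto N U (𝓝 D) := hlim.mono_left hU
    have h2 : Tendsto N U (𝓝 (∑' y, |η y|)) :=
      tendsto_tsum_of_dominated_convergence hBs (fun y => (hη y).abs)
        (Eventually.of_forall fun n y => by simpa using hdB n y)
    exact tendsto_nhds_unique h2 h1
  have hsum0 : ∑' y, η y = 0 := by
    have h2 : Tendsto (fun n => ∑' y, d n y) U (𝓝 (∑' y, η y)) :=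
      tendsto_tsum_of_dominated_convergence hBs hη (Eventually.of_forall fun n y => hdB n y)
    simp only [(hds _).tsum_eq] at h2
    exact tendsto_nhds_unique h2 tendsto_const_nhds
  -- No power of P contracts η, so mixing forbids values of both signs; total mass zero then forces
  -- η = 0.
  have hsign : (∀ y, 0 ≤ η y) ∨ ∀ y, η y ≤ 0 := by
    by_contra! hc
    obtain ⟨⟨b, hb⟩, a, ha⟩ := hc
    obtain ⟨k, z, h1, h2⟩ := hmix a b
    exact not_pos_neg_of_norm_eq (hM0 k) (hM1 k) hηs ((hDk k).trans hDη.symm) ha hb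
      (ENNReal.toReal_pos h1 (hkt _ _ _)) (ENNReal.toReal_pos h2 (hkt _ _ _))
  rw [← hDη]
  rcases hsign with h | h
  · simpa only [abs_of_nonneg (h _)] using hsum0
  · simp only [abs_of_nonpos (h _), tsum_neg, hsum0, neg_zero]

theorem tendsto_iterate_of_mixing {P : S → S → ℝ≥0∞} (hrow : ∀ x, ∑' y, P x y = 1)
    {π : S → ℝ≥0∞} (hπ1 : ∑' y, π y = 1) (hinv : ∀ y, ∑' z, π z * P z y = π y)
    (hmix : ∀ a b, ∃ k z, kpow P k a z ≠ 0 ∧ kpow P k b z ≠ 0) {x : S} (hx : π x ≠ 0)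
    {g : S → ℝ≥0∞} {C : ℝ≥0∞} (hC : C ≠ ⊤) (hg : ∀ y, g y ≤ C) :
    Tendsto (fun n => (app P)^[n] g x) atTop (𝓝 (∑' y, π y * g y)) := by
  have hk : ∀ n, ∑' y, kpow P n x y * g y ≠ ⊤ := fun n => by
    refine ne_top_of_le_ne_top hC ?_
    calc _ ≤ ∑' y, kpow P n x y * C := by gcongr with y; exact hg y
      _ = C := by rw [ENNReal.tsum_mul_right, tsum_kpow_eq_one hrow, one_mul]
  have hπg : ∑' y, π y * g y ≠ ⊤ := by
    refine ne_top_of_le_ne_top hC ?_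
    calc _ ≤ ∑' y, π y * C := by gcongr with y; exact hg y
      _ = C := by rw [ENNReal.tsum_mul_right, hπ1, one_mul]
  simp only [app_iterate]
  rw [← ENNReal.tendsto_toReal_iff hk hπg, tendsto_iff_dist_tendsto_zero]
  have hlim := (tendsto_tsum_abs_sub hrow hπ1 hinv hmix hx).const_mul C.toReal
  rw [mul_zero] at hlim
  refine squeeze_zero (fun _ => dist_nonneg) (fun n => ?_) hlim
  have s1 := ENNReal.summable_toReal (hk n)
  have s2 := ENNReal.summable_toReal hπg
  have s3 : Summable fun y => |(kpow P n x y).toReal - (π y).toReal| :=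
    ((ENNReal.summable_toReal (by rw [tsum_kpow_eq_one hrow]; simp)).sub
      (ENNReal.summable_toReal (by rw [hπ1]; simp))).abs
  have hle : ∀ y, ‖(kpow P n x y * g y).toReal - (π y * g y).toReal‖ ≤
      C.toReal * |(kpow P n x y).toReal - (π y).toReal| := fun y => by
    rw [ENNReal.toReal_mul, ENNReal.toReal_mul, ← sub_mul, Real.norm_eq_abs, abs_mul, mul_comm,
      abs_of_nonneg ENNReal.toReal_nonneg]
    exact mul_le_mul_of_nonneg_right (ENNReal.toReal_mono hC (hg y)) (abs_nonneg _)
  rw [ENNReal.tsum_toReal_eq fun y => ENNReal.ne_top_of_tsum_ne_top (hk n) y,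
    ENNReal.tsum_toReal_eq fun y => ENNReal.ne_top_of_tsum_ne_top hπg y, Real.dist_eq,
    ← Summable.tsum_sub s1 s2, ← tsum_mul_left, ← Real.norm_eq_abs]
  have s4 : Summable fun y => ‖(kpow P n x y * g y).toReal - (π y * g y).toReal‖ :=
    Summable.of_nonneg_of_le (fun _ => norm_nonneg _) hle (s3.mul_left _)
  exact (norm_tsum_le_tsum_norm s4).trans (Summable.tsum_le_tsum hle s4 (s3.mul_left _))

/-- Ratio limits for a positively recurrent kernel: `h` is harmonic and `ν` is invariant. -/
theorem tendsto_iterate_of_harmonic {q : S → S → ℝ≥0∞} {h ν : S → ℝ≥0∞} (h0 : ∀ x, h x ≠ 0)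
    (ht : ∀ x, h x ≠ ⊤) (hh : ∀ x, app q h x = h x) (hν0 : ∀ x, ν x ≠ 0)
    (hν : ∀ y, ∑' z, ν z * q z y = ν y) (hZ : ∑' y, ν y * h y ≠ ⊤)
    (hmix : ∀ a b, ∃ k z, kpow q k a z ≠ 0 ∧ kpow q k b z ≠ 0)
    {f : S → ℝ≥0∞} {C : ℝ≥0∞} (hC : C ≠ ⊤) (hf : ∀ y, f y ≤ C * h y) (x : S) :
    Tendsto (fun n => (app q)^[n] f x) atTop
      (𝓝 (h x * ((∑' y, ν y * h y)⁻¹ * ∑' y, ν y * f y))) := by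
  set Z := ∑' y, ν y * h y with hZdef
  have hZ0 : Z ≠ 0 := by
    intro hz
    have := ENNReal.tsum_eq_zero.1 hz x
    exact mul_ne_zero (hν0 x) (h0 x) this
  -- The Doob transform of `q` by `h`, stochastic because `h` is harmonic, with invariant law νh/Z.
  -- The bound on `f` makes f/h a bounded test function for it.
  let P : S → S → ℝ≥0∞ := fun a b => (h a)⁻¹ * (q a b * h b)
  have hP : ∀ n a b, kpow P n a b = (h a)⁻¹ * (kpow q n a b * h b) := by
    intro n a b
    induction n generalizing b with
    | zero =>
      by_cases hab : a = b
      · subst hab; simp [kpow, pt, ENNReal.inv_mul_cancel (h0 a) (ht a)]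
      · simp [kpow, pt, hab]
    | succ n ih =>
      simp only [kpow, ih, P, ← ENNReal.tsum_mul_left, ← ENNReal.tsum_mul_right]
      refine tsum_congr fun z => ?_
      calc _ = (h a)⁻¹ * (kpow q n a z * q z b * h b) * (h z * (h z)⁻¹) := by ring
        _ = _ := by rw [ENNReal.mul_inv_cancel (h0 z) (ht z), mul_one]
  let π : S → ℝ≥0∞ := fun y => Z⁻¹ * (ν y * h y)
  have hrow : ∀ a, ∑' b, P a b = 1 := fun a => by
    simp only [P, ENNReal.tsum_mul_left]
    rw [show ∑' b, q a b * h b = h a from hh a, ENNReal.inv_mul_cancel (h0 a) (ht a)]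
  have hπ1 : ∑' y, π y = 1 := by
    simp only [π, ENNReal.tsum_mul_left]; exact ENNReal.inv_mul_cancel hZ0 hZ
  have hinv : ∀ y, ∑' z, π z * P z y = π y := fun y => by
    have : ∀ z, π z * P z y = Z⁻¹ * (ν z * q z y) * h y := fun z => by
      calc π z * P z y = Z⁻¹ * (ν z * q z y) * h y * (h z * (h z)⁻¹) := by simp only [π, P]; ring
        _ = _ := by rw [ENNReal.mul_inv_cancel (h0 z) (ht z), mul_one]
    simp only [this, ENNReal.tsum_mul_left, ENNReal.tsum_mul_right, hν]
    simp only [π, mul_assoc]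
  have hi : ∀ a, (h a)⁻¹ ≠ 0 := fun a => ENNReal.inv_ne_zero.2 (ht a)
  have hmixP : ∀ a b, ∃ k z, kpow P k a z ≠ 0 ∧ kpow P k b z ≠ 0 := fun a b => by
    obtain ⟨k, z, h1, h2⟩ := hmix a b
    refine ⟨k, z, ?_, ?_⟩ <;> rw [hP]
    · exact mul_ne_zero (hi a) (mul_ne_zero h1 (h0 z))
    · exact mul_ne_zero (hi b) (mul_ne_zero h2 (h0 z))
  have hπx : π x ≠ 0 := mul_ne_zero (ENNReal.inv_ne_zero.2 hZ) (mul_ne_zero (hν0 x) (h0 x))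
  have hlim := tendsto_iterate_of_mixing hrow hπ1 hinv hmixP hπx (g := fun y => f y * (h y)⁻¹) hC
    (fun y => by
      calc f y * (h y)⁻¹ ≤ C * h y * (h y)⁻¹ := by gcongr; exact hf y
        _ = C := by rw [mul_assoc, ENNReal.mul_inv_cancel (h0 y) (ht y), mul_one])
  have hlim2 := ENNReal.Tendsto.const_mul (a := h x) hlim (Or.inr (ht x))
  convert hlim2 using 2
  · rw [app_iterate, app_iterate, ← ENNReal.tsum_mul_left]
    refine tsum_congr fun y => ?_
    rw [hP]
    calc _ = kpow q _ x y * f y * 1 * 1 := by ring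
      _ = kpow q _ x y * f y * (h x * (h x)⁻¹) * (h y * (h y)⁻¹) := by
        rw [ENNReal.mul_inv_cancel (h0 x) (ht x), ENNReal.mul_inv_cancel (h0 y) (ht y)]
      _ = _ := by ring
  · rw [← ENNReal.tsum_mul_left]
    congr 1
    refine tsum_congr fun y => ?_
    calc _ = Z⁻¹ * (ν y * f y) * 1 := by ring
      _ = Z⁻¹ * (ν y * f y) * (h y * (h y)⁻¹) := by rw [ENNReal.mul_inv_cancel (h0 y) (ht y)]
      _ = _ := by simp only [π]; ring

/-- The possible return times form an additive submonoid of ℕ with gcd one, which contains all large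
integers. -/
theorem exists_forall_ge_kpow_pos {q : S → S → ℝ≥0∞} {x : S}
    (hap : ∀ d : ℕ, (∀ n : ℕ, 1 ≤ n → 0 < kpow q n x x → d ∣ n) → d = 1) :
    ∃ N, ∀ n ≥ N, 0 < kpow q n x x := by
  let T : AddSubmonoid ℕ :=
    { carrier := {n | 0 < kpow q n x x}
      zero_mem' := by simp [kpow, pt]
      add_mem' := fun {a b} ha hb =>
        (ENNReal.mul_pos (ne_of_gt ha) (ne_of_gt hb)).trans_le (mul_kpow_le q a b x x x) }
  obtain ⟨N, hN⟩ := Nat.exists_mem_closure_of_ge (T : Set ℕ)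
  have h1 : Nat.setGcd (T : Set ℕ) = 1 := hap _ fun n _ h0 => Nat.setGcd_dvd_of_mem h0
  refine ⟨N, fun n hn => ?_⟩
  have := hN n hn (by rw [h1]; exact one_dvd n)
  rw [AddSubmonoid.closure_eq] at this
  exact this

theorem Irr.exists_common {q : S → S → ℝ≥0∞} (hirr : Irr q)
    (hap : ∀ x : S, ∀ d : ℕ, (∀ n : ℕ, 1 ≤ n → 0 < kpow q n x x → d ∣ n) → d = 1) (a b : S) :
    ∃ k z, kpow q k a z ≠ 0 ∧ kpow q k b z ≠ 0 := by
  obtain ⟨N, hN⟩ := exists_forall_ge_kpow_pos (hap b)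
  obtain ⟨m, -, hm⟩ := hirr a b
  -- Both paths end at `b` and have length m + N: from `a`, go to `b` and loop `N` steps; from `b`,
  -- loop throughout.
  refine ⟨m + N, b, ?_, (hN _ (by omega)).ne'⟩
  exact ((ENNReal.mul_pos hm.ne' (hN N le_rfl).ne').trans_le (mul_kpow_le q m N a b b)).ne'

end Ergodic

/-! ### The critical parameter: infinite regime and recurrence. -/

section Critical

variable {S : Type*}

/-- The kernel `e ^ l p` on `S`. -/
def tilt (p : Option S → PMF (Option S)) (l : ℝ) (x y : S) : ℝ≥0∞ :=
  ENNReal.ofReal (Real.exp l) * onS p x y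

theorem tsum_onS_le (p : Option S → PMF (Option S)) (x : S) : ∑' y, onS p x y ≤ 1 := by
  rw [← tsum_option_pmf (p (some x))]; exact le_add_self

theorem ofReal_exp_ne_zero (l : ℝ) : ENNReal.ofReal (Real.exp l) ≠ 0 := by
  simpa using Real.exp_pos l

theorem tsum_tilt_le (p : Option S → PMF (Option S)) (l : ℝ) (x : S) :
    ∑' y, tilt p l x y ≤ ENNReal.ofReal (Real.exp l) := by
  simp only [tilt, ENNReal.tsum_mul_left]
  exact mul_le_of_le_one_right' (tsum_onS_le p x)

theorem tilt_mono (p : Option S → PMF (Option S)) {l₁ l₂ : ℝ} (h : l₁ ≤ l₂) (x y : S) :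
    tilt p l₁ x y ≤ tilt p l₂ x y := by
  simp only [tilt]; gcongr

theorem const_mul_tilt (p : Option S → PMF (Option S)) (l : ℝ) {s : ℝ≥0∞} (h1 : 1 < s)
    (hs : s ≠ ⊤) :
    ∃ l', l < l' ∧ (fun x y => s * tilt p l x y) = tilt p l' := by
  have hs1 : 1 < s.toReal := by
    rwa [← ENNReal.toReal_one, ENNReal.toReal_lt_toReal (by simp) hs]
  refine ⟨l + Real.log s.toReal, lt_add_of_pos_right _ (Real.log_pos hs1), ?_⟩
  funext x y
  rw [tilt, tilt, Real.exp_add, Real.exp_log (by linarith), ENNReal.ofReal_mul (Real.exp_pos _).le,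
    ENNReal.ofReal_toReal hs]
  ring

theorem irr_tilt {p : Option S → PMF (Option S)} (hirr : Irr (onS p)) (l : ℝ) : Irr (tilt p l) :=
  hirr.const_mul (ofReal_exp_ne_zero l)

theorem irr_onS {p : Option S → PMF (Option S)} (hirr : IsIrreducibleOnS p) : Irr (onS p) := by
  intro x y
  simpa only [restrictedStep_eq] using hirr x y

theorem exists_forall_mem_le {K : Set S} (hK : K.Finite) {f : S → ℝ≥0∞} (hf : ∀ x, f x ≠ ⊤) :
    ∃ m, m ≠ ⊤ ∧ ∀ k ∈ K, f k ≤ m :=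
  ⟨∑ k ∈ hK.toFinset, f k, (ENNReal.sum_lt_top.2 fun k _ => (hf k).lt_top).ne, fun _ hk =>
    Finset.single_le_sum (f := f) (fun _ _ => zero_le) (hK.mem_toFinset.2 hk)⟩

/-- A potential dominated by `e ^ l p` that is finite is bounded. -/
theorem exists_pot_le {p : Option S → PMF (Option S)} {l : ℝ} {K : Set S} (hK : K.Finite)
    {C : ℝ≥0∞} (hC : C ≠ ⊤) (hu : ∀ x, pot (tab K (tilt p l)) 1 x ≤ C) {T : S → S → ℝ≥0∞}
    (hT : ∀ x y, T x y ≤ tilt p l x y) (hfin : ∀ x, pot T 1 x ≠ ⊤) :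
    ∃ D, D ≠ ⊤ ∧ ∀ x, pot T 1 x ≤ D := by
  obtain ⟨m, hm, hmK⟩ := exists_forall_mem_le hK hfin
  refine ⟨(1 + ENNReal.ofReal (Real.exp l) * m) * C, ?_, fun x => ?_⟩
  · finiteness
  · exact (pot_le_mul_pot_tab hT (tsum_tilt_le p l) K hmK x).trans (by gcongr; exact hu x)

theorem lambdaCr_pos {p : Option S → PMF (Option S)} (hmom : HasExpMoment p)
    (hbdd : BddAbove {l : ℝ | 0 < l ∧ ∃ x : S, absMGF p l x < ⊤}) : 0 < lambdaCr p := by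
  obtain ⟨b, hb, hx⟩ := hmom
  exact hb.trans_le (le_csSup hbdd ⟨hb, hx⟩)

/-- A power series in e^l with coefficients free of `l`, so bounds below the critical parameter pass
to it. -/
theorem hit_tilt_eq (p : Option S → PMF (Option S)) (l : ℝ) (x : S) :
    hit (tilt p l) x x = ∑' n : ℕ, ENNReal.ofReal (Real.exp l) ^ (n + 1) *
      ∑' z, kpow (tab {x} (onS p)) n x z * onS p z x := by
  refine tsum_congr fun n => ?_
  change (app (tab {x} fun a b => ENNReal.ofReal (Real.exp l) * onS p a b))^[n] _ x = _
  rw [tab_const_mul, app_iterate, ← ENNReal.tsum_mul_left]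
  exact tsum_congr fun z => by rw [kpow_const_mul, tilt]; ring

variable [Countable S]

theorem lintegral_min_lt_top_iff (p : Option S → PMF (Option S)) (x : S) (K : Set S) {l : ℝ}
    (hl : 0 < l) :
    ∫⁻ ω, expTime l (min (tauAbs ω) (tauSet K ω)) ∂(PrAt p x) < ⊤ ↔
      pot (tab K (tilt p l)) 1 x < ⊤ := by
  simp only [min_tauAbs_tauSet]
  rw [lintegral_expTime_lt_top_iff p x (Or.inl rfl) hl, preimage_none_union]
  rfl

theorem lintegral_min_tau_lt_top_iff (p : Option S → PMF (Option S)) (x y : S) {l : ℝ}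
    (hl : 0 < l) :
    ∫⁻ ω, expTime l (min (tauAbs ω) (tau x ω)) ∂(PrAt p y) < ⊤ ↔
      pot (tab {x} (tilt p l)) 1 y < ⊤ := by
  simp only [min_tauAbs_tau]
  rw [lintegral_expTime_lt_top_iff p y (Or.inl rfl) hl, preimage_none_union]
  rfl

/-- The hypothesis only concerns starting points off `K`. Points of `K` follow after one step, since
entry into `K` is killed. -/
theorem exists_pot_tab_le {p : Option S → PMF (Option S)} {l : ℝ} (hl : 0 < l) {K : Set S}
    (h : (⨆ x : S, ⨆ _ : x ∉ K,
      ∫⁻ ω, expTime l (min (tauAbs ω) (tauSet K ω)) ∂(PrAt p x)) < ⊤) :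
    ∃ C, C ≠ ⊤ ∧ ∀ x, pot (tab K (tilt p l)) 1 x ≤ C := by
  set c := ⨆ x : S, ⨆ _ : x ∉ K,
      ∫⁻ ω, expTime l (min (tauAbs ω) (tauSet K ω)) ∂(PrAt p x) with hc
  set r := ENNReal.ofReal (Real.exp l) with hr
  have hr1 : r - 1 ≠ 0 := (tsub_pos_of_lt (one_lt_ofReal_exp hl)).ne'
  have hrt : r - 1 ≠ ⊤ := ENNReal.sub_ne_top ENNReal.ofReal_ne_top
  have hB : ∀ x ∉ K, pot (tab K (tilt p l)) 1 x ≤ c / (r - 1) := fun x hx => by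
    rw [ENNReal.le_div_iff_mul_le (Or.inl hr1) (Or.inl hrt), mul_comm]
    have h1 : ∫⁻ ω, expTime l (min (tauAbs ω) (tauSet K ω)) ∂(PrAt p x) ≤ c :=
      le_iSup₂ (f := fun (x : S) (_ : x ∉ K) =>
        ∫⁻ ω, expTime l (min (tauAbs ω) (tauSet K ω)) ∂(PrAt p x)) x hx
    simp only [min_tauAbs_tauSet] at h1
    rw [lintegral_expTime p x (Or.inl rfl) hl, preimage_none_union] at h1
    exact le_add_self.trans h1
  have hB2 : ∀ x, pot (tab K (tilt p l)) 1 x ≤ 1 + r * (c / (r - 1)) := fun x => by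
    rw [pot_eq]
    refine add_le_add le_rfl ?_
    calc app (tab K (tilt p l)) (pot (tab K (tilt p l)) 1) x
        ≤ ∑' y, tilt p l x y * (c / (r - 1)) := by
          refine ENNReal.tsum_le_tsum fun y => ?_
          by_cases hy : y ∈ K
          · simp [tab, hy]
          · simp only [tab, hy, if_false]
            gcongr; exact hB y hy
      _ ≤ r * (c / (r - 1)) := by
          rw [ENNReal.tsum_mul_right]; gcongr; exact tsum_tilt_le p l x
  exact ⟨_, by
    have := ENNReal.div_ne_top h.ne hr1
    finiteness, hB2⟩

theorem pot_tilt_ne_top {p : Option S → PMF (Option S)} (hirr : Irr (onS p)) {l : ℝ}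
    (hl : 0 < l) {x : S} (h : absMGF p l x < ⊤) (y : S) : pot (tilt p l) 1 y ≠ ⊤ :=
  (irr_tilt hirr l).ne_top_of_superharmonic (app_pot_le _ _)
    (fun hx => h.ne ((absMGF_eq_top_iff p x hl).2 hx)) y

theorem absMGF_lt_top {p : Option S → PMF (Option S)} {l : ℝ} (hl : 0 < l) {x : S}
    (h : pot (tilt p l) 1 x ≠ ⊤) : absMGF p l x < ⊤ :=
  lt_top_iff_ne_top.2 fun hx => h ((absMGF_eq_top_iff p x hl).1 hx)

theorem le_of_absMGF_lt_top {p : Option S → PMF (Option S)} (hirr : Irr (onS p)) {lbar l : ℝ}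
    (h : 0 < lbar) {x y : S} (hx : absMGF p lbar x = ⊤) (hl : 0 < l) (hy : absMGF p l y < ⊤) :
    l ≤ lbar := by
  by_contra! hlt
  refine pot_tilt_ne_top hirr hl hy x (top_le_iff.1 ?_)
  have h1 : pot (tilt p lbar) 1 x = ⊤ := (absMGF_eq_top_iff p x h).1 hx
  rw [← h1]
  exact pot_mono (tilt_mono p hlt.le) (fun _ => le_rfl) x

theorem pot_tilt_ne_top_of_lt {p : Option S → PMF (Option S)} (hirr : Irr (onS p))
    (hmom : HasExpMoment p) {l : ℝ} (hl : l < lambdaCr p) (y : S) : pot (tilt p l) 1 y ≠ ⊤ := by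
  obtain ⟨b, hb, hx⟩ := hmom
  obtain ⟨l', ⟨hl'0, x, hx⟩, hl'⟩ := exists_lt_of_lt_csSup (s := {l : ℝ | 0 < l ∧
    ∃ x : S, absMGF p l x < ⊤}) ⟨b, hb, hx⟩ hl
  refine ne_top_of_le_ne_top (pot_tilt_ne_top hirr hl'0 hx y) ?_
  exact pot_mono (tilt_mono p hl'.le) (fun _ => le_rfl) y

/-- Under the arrival condition the critical parameter is in the infinite regime. -/
theorem pot_tilt_lambdaCr {p : Option S → PMF (Option S)} (hirr : Irr (onS p))
    (hpos : 0 < lambdaCr p) (hbdd : BddAbove {l : ℝ | 0 < l ∧ ∃ x : S, absMGF p l x < ⊤})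
    {K : Set S} (hK : K.Finite) {C : ℝ≥0∞} (hC : C ≠ ⊤)
    (hu : ∀ x, pot (tab K (tilt p (lambdaCr p))) 1 x ≤ C) (x : S) :
    pot (tilt p (lambdaCr p)) 1 x = ⊤ := by
  by_contra hx
  have hfin := (irr_tilt hirr _).ne_top_of_superharmonic (app_pot_le _ _) hx
  obtain ⟨D, hD, hDx⟩ := exists_pot_le hK hC hu (fun _ _ => le_rfl) hfin
  obtain ⟨s, hs1, hst, hs⟩ := exists_pot_const_mul_le hD hDx
  obtain ⟨l', hl', he⟩ := const_mul_tilt p (lambdaCr p) hs1 hst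
  rw [he] at hs
  have : absMGF p l' x < ⊤ := absMGF_lt_top (hpos.trans hl')
    (ne_top_of_le_ne_top (by finiteness) (hs x))
  exact absurd (le_csSup hbdd ⟨hpos.trans hl', x, this⟩) (not_le.2 hl')

theorem continuous_ofReal_exp : Continuous fun l : ℝ => ENNReal.ofReal (Real.exp l) :=
  ENNReal.continuous_ofReal.comp Real.continuous_exp

theorem hit_tilt_le_one_of_lt {p : Option S → PMF (Option S)} (hirr : Irr (onS p))
    (hmom : HasExpMoment p) {l : ℝ} (hl : l < lambdaCr p) (x : S) :
    hit (tilt p l) x x ≤ 1 :=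
  hit_self_le_one (h := pot (tilt p l) 1) (app_pot_le _ _)
    (zero_lt_one.trans_le (le_pot (tilt p l) 1 x)).ne' (pot_tilt_ne_top_of_lt hirr hmom hl x)

/-- Below the critical parameter the potential is finite, positive and superharmonic, which bounds
the return weight by 1. Each partial sum of the series is continuous in `l`, so the bound survives
the left limit. -/
theorem hit_tilt_le_one {p : Option S → PMF (Option S)} (hirr : Irr (onS p))
    (hmom : HasExpMoment p) (x : S) : hit (tilt p (lambdaCr p)) x x ≤ 1 := by
  set a : ℕ → ℝ≥0∞ := fun n => ∑' z, kpow (tab {x} (onS p)) n x z * onS p z x with ha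
  have ha1 : ∀ n, a n ≠ ⊤ := by
    have key : ∀ n, ∑' z, kpow (tab {x} (onS p)) n x z ≤ 1 := fun n => by
      have := iterate_le_of_superharmonic (q := tab {x} (onS p)) (h := fun _ => 1) (fun y => by
        simp only [app, mul_one]
        exact (ENNReal.tsum_le_tsum fun z => tab_le _ _ _ _).trans (tsum_onS_le p y)) n x
      simpa [app_iterate] using this
    intro n
    refine ne_top_of_le_ne_top (b := 1) (by simp) (le_trans ?_ (key n))
    refine ENNReal.tsum_le_tsum fun z => mul_le_of_le_one_right' ?_
    exact PMF.coe_le_one _ _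
  rw [hit_tilt_eq]
  refine ENNReal.tsum_le_of_sum_range_le fun N => ?_
  have hcont : Continuous fun l : ℝ => ∑ n ∈ Finset.range N,
      ENNReal.ofReal (Real.exp l) ^ (n + 1) * a n :=
    continuous_finsetSum _ fun n _ => (ENNReal.continuous_mul_const (ha1 n)).comp
      ((ENNReal.continuous_pow (n + 1)).comp continuous_ofReal_exp)
  refine le_of_tendsto (hcont.continuousWithinAt (s := Set.Iio (lambdaCr p))) ?_
  filter_upwards [self_mem_nhdsWithin] with l hl
  exact ((ENNReal.sum_le_tsum _).trans (hit_tilt_eq p l x).symm.le).trans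
    (hit_tilt_le_one_of_lt hirr hmom hl x)

/-- The superharmonic function needed for finiteness is `hit` itself; finiteness on `K` then
upgrades to a uniform bound. -/
theorem exists_pot_tab_singleton_le {p : Option S → PMF (Option S)} (hirr : Irr (onS p))
    (hmom : HasExpMoment p) {K : Set S} (hK : K.Finite) {C : ℝ≥0∞} (hC : C ≠ ⊤)
    (hu : ∀ x, pot (tab K (tilt p (lambdaCr p))) 1 x ≤ C) (x : S) :
    ∃ D, D ≠ ⊤ ∧ ∀ y, pot (tab {x} (tilt p (lambdaCr p))) 1 y ≤ D := by
  have hI := irr_tilt hirr (lambdaCr p)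
  have h1 := hit_tilt_le_one hirr hmom x
  refine exists_pot_le hK hC hu (tab_le _ _) fun y => ?_
  exact hI.pot_tab_singleton_ne_top (app_hit_le h1) (hI.hit_ne_zero h1)
    (hI.ne_top_of_superharmonic (app_hit_le h1) (ne_top_of_le_ne_top (by simp) h1)) hK hC hu x y

end Critical

/-! ### Invariant probabilities and quasistationary distributions. -/

section Invariant

variable {S : Type*}

/-- Existence and uniqueness of the invariant probability of a recurrent kernel with finite mean
excursion weights. -/
theorem Irr.exists_unique_invariant {q : S → S → ℝ≥0∞} (hirr : Irr q) [Nonempty S]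
    (hx : ∀ x, hit q x x = 1) (hfin : ∀ x, pot (tab {x} q) 1 x ≠ ⊤) :
    ∃ ν : PMF S, (∀ y, ∑' z, ν z * q z y = ν y) ∧ (∀ x, ν x = (pot (tab {x} q) 1 x)⁻¹) ∧
      ∀ ν' : PMF S, (∀ y, ∑' z, ν' z * q z y = ν' y) → ν' = ν := by
  have hval : ∀ v : PMF S, (∀ y, ∑' z, v z * q z y = v y) →
      ∀ x, v x = (pot (tab {x} q) 1 x)⁻¹ := by
    intro v hv x
    have h := fun y => hirr.eq_mul_green_of_invariant (hx x) (fun y => v.apply_ne_top y) hv y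
    -- The invariant measure is v(x) times the Green row of the excursion from `x`; its total mass 1
    -- determines v(x).
    have h1 : v x * pot (tab {x} q) 1 x = 1 := by
      rw [pot_eq_tsum_green, ← ENNReal.tsum_mul_left, ← v.tsum_coe]
      exact tsum_congr fun y => by rw [h y]; simp
    exact ENNReal.eq_inv_of_mul_eq_one_left h1
  obtain ⟨x₀⟩ := ‹Nonempty S›
  set H := pot (tab {x₀} q) 1 x₀ with hH
  have hH0 : H ≠ 0 := (zero_lt_one.trans_le (le_pot (tab {x₀} q) 1 x₀)).ne'
  have hsum : ∑' y, H⁻¹ * green (tab {x₀} q) x₀ y = 1 := by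
    rw [ENNReal.tsum_mul_left]
    have : ∑' y, green (tab {x₀} q) x₀ y = H := by rw [hH, pot_eq_tsum_green]; simp
    rw [this, ENNReal.inv_mul_cancel hH0 (hfin x₀)]
  let ν : PMF S := ⟨fun y => H⁻¹ * green (tab {x₀} q) x₀ y, by
    rw [← hsum]; exact ENNReal.summable.hasSum⟩
  have hν : ∀ y, ν y = H⁻¹ * green (tab {x₀} q) x₀ y := fun _ => rfl
  have hinv : ∀ y, ∑' z, ν z * q z y = ν y := fun y => by
    simp only [hν, mul_assoc, ENNReal.tsum_mul_left, green_tab_invariant (hx x₀)]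
  exact ⟨ν, hinv, hval ν hinv, fun ν' h' => PMF.ext fun x => by rw [hval ν' h', hval ν hinv]⟩

theorem tab_empty (q : S → S → ℝ≥0∞) : tab ∅ q = q := by funext x y; simp [tab]

theorem some_preimage_none : (some ⁻¹' {none} : Set S) = ∅ := by ext x; simp

theorem tsum_mul_iterate_of_invariant {q : S → S → ℝ≥0∞} {v : S → ℝ≥0∞} {c : ℝ≥0∞}
    (hv : ∀ y, ∑' z, v z * q z y = c * v y) (n : ℕ) (f : S → ℝ≥0∞) :
    ∑' x, v x * (app q)^[n] f x = c ^ n * ∑' y, v y * f y := by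
  simp only [app_iterate, ← ENNReal.tsum_mul_left]
  rw [ENNReal.tsum_comm]
  refine tsum_congr fun y => ?_
  rw [← mul_assoc, ← tsum_mul_kpow_of_invariant hv n y, ← ENNReal.tsum_mul_right]
  exact tsum_congr fun x => by ring

theorem tsum_mul_indicator_one (ν : PMF S) (A : Set S) :
    ∑' y, ν y * (A.indicator 1 : S → ℝ≥0∞) y = ν.toOuterMeasure A := by
  rw [PMF.toOuterMeasure_apply]
  refine tsum_congr fun y => ?_
  by_cases hy : y ∈ A <;> simp [hy]

theorem eigen_of_invariant {p : Option S → PMF (Option S)} {ν : PMF S} {l : ℝ}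
    (h : ∀ y, ∑' z, ν z * tilt p l z y = ν y) (y : S) :
    ∑' z, ν z * onS p z y = ENNReal.ofReal (Real.exp (-l)) * ν y := by
  rw [← h y, ← ENNReal.tsum_mul_left]
  refine tsum_congr fun z => ?_
  have e : ENNReal.ofReal (Real.exp (-l)) * ENNReal.ofReal (Real.exp l) = 1 := by
    rw [← ENNReal.ofReal_mul (Real.exp_pos _).le, ← Real.exp_add]; simp
  calc ν z * onS p z y = ν z * onS p z y * 1 := (mul_one _).symm
    _ = _ := by rw [← e, tilt]; ring

/-- A geometric series in e^l c. When e^l c ≥ 1, truncated subtraction gives 0 and the inverse is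
`⊤`, in agreement with divergence. -/
theorem tsum_mul_pot_tilt {p : Option S → PMF (Option S)} {ν : PMF S} {c : ℝ≥0∞}
    (h : ∀ y, ∑' z, ν z * onS p z y = c * ν y) (l : ℝ) :
    ∑' x, ν x * pot (tilt p l) 1 x = (1 - ENNReal.ofReal (Real.exp l) * c)⁻¹ := by
  have h' : ∀ y, ∑' z, ν z * tilt p l z y = (ENNReal.ofReal (Real.exp l) * c) * ν y := fun y => by
    rw [mul_assoc, ← h, ← ENNReal.tsum_mul_left]
    exact tsum_congr fun z => by rw [tilt]; ring
  simp only [pot, ← ENNReal.tsum_mul_left]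
  rw [ENNReal.tsum_comm]
  simp only [tsum_mul_iterate_of_invariant h', Pi.one_apply, mul_one, ν.tsum_coe]
  exact ENNReal.tsum_geometric _

/-- Mass balance over an excursion. Each step of weight e^l goes to Δ, to `x`, or elsewhere. Summed,
with G the excursion weight, these contribute the absorption term, the return weight 1, and G - 1;
hence e^l G is the absorption term plus G, and the finite G cancels. -/
theorem mul_pot_kill {p : Option S → PMF (Option S)} {l : ℝ} (hl : 0 < l) {x : S}
    (hx : hit (tilt p l) x x = 1) (hfin : pot (tab {x} (tilt p l)) 1 x ≠ ⊤) :
    ENNReal.ofReal (Real.exp l) * pot (tab {x} (tilt p l)) (fun z => p (some z) none) x =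
      (ENNReal.ofReal (Real.exp l) - 1) * pot (tab {x} (tilt p l)) 1 x := by
  set r := ENNReal.ofReal (Real.exp l) with hr
  set t := tab {x} (tilt p l) with ht
  have e1 : ∀ z, r * (1 : S → ℝ≥0∞) z = r * p (some z) none + (app t 1 z + tilt p l z x) := by
    intro z
    have : app t 1 z + tilt p l z x = app (tilt p l) 1 z := by
      rw [app_eq_tab_add (q := tilt p l) x, Pi.one_apply, mul_one]
    rw [this, Pi.one_apply, ← tsum_option_pmf (p (some z)), mul_add]
    congr 1
    simp [app, tilt, onS, ENNReal.tsum_mul_left, hr]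
  have e2 : r * pot t 1 x = r * pot t (fun z => p (some z) none) x + (pot t (app t 1) x + 1) := by
    rw [← hx, hit, ← pot_const_mul, ← pot_const_mul, ← ht, ← pot_add, ← pot_add]
    congr 1; funext z; exact e1 z
  rw [add_comm _ (1 : ℝ≥0∞)] at e2
  have e3 : pot t 1 x = 1 + pot t (app t 1) x := pot_eq_add_pot_app t 1 x
  rw [← e3] at e2
  refine (ENNReal.add_left_inj hfin).1 ?_
  rw [← e2]
  conv_lhs => rw [← tsub_add_cancel_of_le (show 1 ≤ r from (one_lt_ofReal_exp hl).le), add_mul,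
    one_mul]

variable [Countable S]

theorem condLaw_eq (p : Option S → PMF (Option S)) (μ : PMF S) (n : ℕ) (A : Set S) :
    condLaw p μ n A = (∑' x, μ x * (app (onS p))^[n] 1 x)⁻¹ *
      ∑' x, μ x * (app (onS p))^[n] (A.indicator 1) x := by
  have hm := measurableSet_lt_retTime (S := S) {none} n
  rw [condLaw]
  simp only [tauAbs]
  rw [cond_apply hm, Pr_apply p μ hm, Pr_apply p μ (hm.inter (measurableSet_eval n _))]
  have e1 : ∀ x, PrAt p x {ω | (n : ℕ∞) < retTime {none} ω} = (app (onS p))^[n] 1 x := fun x => by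
    rw [PrAt_lt_retTime p x (A := {none}) rfl, some_preimage_none, tab_empty]
  have e2 : ∀ x, PrAt p x ({ω | (n : ℕ∞) < retTime {none} ω} ∩ {ω | ω n ∈ some '' A}) =
      (app (onS p))^[n] (A.indicator 1) x := fun x => by
    have := PrAt_lt_retTime_mem p x (A := {none}) rfl n A
    rwa [some_preimage_none, tab_empty] at this
  simp only [e1, e2]

theorem isQSD_of_eigen {p : Option S → PMF (Option S)} {ν : PMF S} {c : ℝ≥0∞} (hc0 : c ≠ 0)
    (hct : c ≠ ⊤) (h : ∀ y, ∑' z, ν z * onS p z y = c * ν y) : IsQSD p ν := by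
  intro n _ A
  rw [condLaw_eq, tsum_mul_iterate_of_invariant h, tsum_mul_iterate_of_invariant h,
    tsum_mul_indicator_one]
  simp only [Pi.one_apply, mul_one, ν.tsum_coe]
  rw [← mul_assoc, ENNReal.inv_mul_cancel (pow_ne_zero n hc0) (ENNReal.pow_ne_top hct), one_mul]

theorem IsQSD.exists_eigen {p : Option S → PMF (Option S)} {ν : PMF S} (h : IsQSD p ν) :
    ∃ c : ℝ≥0∞, ∀ y, ∑' z, ν z * onS p z y = c * ν y := by
  have h1 := fun A => h 1 le_rfl A
  simp only [condLaw_eq, Function.iterate_one] at h1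
  set c := ∑' x, ν x * app (onS p) 1 x with hc
  have hct : c ≠ ⊤ := by
    refine ne_top_of_le_ne_top (b := 1) (by simp) ?_
    rw [← ν.tsum_coe]
    refine ENNReal.tsum_le_tsum fun x => mul_le_of_le_one_right' ?_
    simpa [app] using tsum_onS_le p x
  -- If survival for one step had probability zero, the conditional law would give S mass 0 instead
  -- of 1.
  have hc0 : c ≠ 0 := by
    intro h0
    have h2 := h1 Set.univ
    rw [Set.indicator_univ, ← hc, h0, mul_zero, PMF.toOuterMeasure_apply] at h2
    simp at h2
  refine ⟨c, fun y => ?_⟩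
  have h2 := h1 {y}
  rw [PMF.toOuterMeasure_apply_singleton] at h2
  rw [← h2, ← mul_assoc, ENNReal.mul_inv_cancel hc0 hct, one_mul]
  refine tsum_congr fun x => ?_
  rw [app, tsum_eq_single y (fun z hz => by simp [hz])]
  simp

/-- Every quasistationary distribution is minimal. -/
theorem IsQSD.invariant {p : Option S → PMF (Option S)} {ν : PMF S} (h : IsQSD p ν)
    (hinf : ∀ x, pot (tilt p (lambdaCr p)) 1 x = ⊤)
    (hbd : ∀ l < lambdaCr p, ∃ D, D ≠ ⊤ ∧ ∀ x, pot (tilt p l) 1 x ≤ D) (y : S) :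
    ∑' z, ν z * tilt p (lambdaCr p) z y = ν y := by
  obtain ⟨c, hc⟩ := h.exists_eigen
  set r := ENNReal.ofReal (Real.exp (lambdaCr p)) with hr
  have h1 : 1 ≤ r * c := by
    have e := tsum_mul_pot_tilt hc (lambdaCr p)
    simp only [hinf, ENNReal.tsum_mul_right, ν.tsum_coe, one_mul] at e
    exact tsub_eq_zero_iff_le.1 (ENNReal.inv_eq_top.1 e.symm)
  have hct : c ≠ ⊤ := by
    rintro rfl
    obtain ⟨z, hz⟩ : ∃ z, ν z ≠ 0 := by
      by_contra! h0
      have := ν.tsum_coe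
      simp [h0] at this
    have h2 := hc z
    rw [ENNReal.top_mul hz] at h2
    refine absurd h2 (ne_top_of_le_ne_top (b := 1) (by simp) ?_)
    rw [← ν.tsum_coe]
    exact ENNReal.tsum_le_tsum fun x => mul_le_of_le_one_right' (PMF.coe_le_one _ _)
  -- Integrating against ν needs a bounded potential, not just a finite one: boundedness makes the
  -- geometric series converge for each `l` below the critical value.
  have h2 : r * c ≤ 1 := by
    have hcont : Continuous fun l : ℝ => ENNReal.ofReal (Real.exp l) * c :=
      (ENNReal.continuous_mul_const hct).comp continuous_ofReal_exp
    refine le_of_tendsto (hcont.continuousWithinAt (s := Set.Iio (lambdaCr p))) ?_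
    filter_upwards [self_mem_nhdsWithin] with l hl
    obtain ⟨D, hD, hDx⟩ := hbd l hl
    have e := tsum_mul_pot_tilt hc l
    have : ∑' x, ν x * pot (tilt p l) 1 x ≤ D := by
      calc _ ≤ ∑' x, ν x * D := by gcongr with x; exact hDx x
        _ = D := by rw [ENNReal.tsum_mul_right, ν.tsum_coe, one_mul]
    rw [e] at this
    by_contra! hlt
    rw [tsub_eq_zero_of_le hlt.le, ENNReal.inv_zero, top_le_iff] at this
    exact hD this
  calc _ = r * ∑' z, ν z * onS p z y := by
        rw [← ENNReal.tsum_mul_left]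
        exact tsum_congr fun z => by rw [tilt]; ring
    _ = (r * c) * ν y := by rw [hc, mul_assoc]
    _ = ν y := by rw [le_antisymm h2 h1, one_mul]

end Invariant

/-! ### Convergence of the conditional laws. -/

section Limit

variable {S : Type*}

theorem tendsto_tsum_of_le {F : ℕ → S → ℝ≥0∞} {G b : S → ℝ≥0∞} (hb : ∑' x, b x ≠ ⊤)
    (hF : ∀ n x, F n x ≤ b x) (hlim : ∀ x, Tendsto (fun n => F n x) atTop (𝓝 (G x))) :
    Tendsto (fun n => ∑' x, F n x) atTop (𝓝 (∑' x, G x)) := by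
  let _ : MeasurableSpace S := ⊤
  simp only [← lintegral_count]
  rw [← lintegral_count] at hb
  exact tendsto_lintegral_of_dominated_convergence b (fun _ => measurable_from_top)
    (fun n => Eventually.of_forall (hF n)) hb (Eventually.of_forall hlim)

theorem app_tilt_iterate (p : Option S → PMF (Option S)) (l : ℝ) (n : ℕ) (f : S → ℝ≥0∞) (x : S) :
    (app (tilt p l))^[n] f x = ENNReal.ofReal (Real.exp l) ^ n * (app (onS p))^[n] f x := by
  rw [app_iterate, app_iterate, ← ENNReal.tsum_mul_left]
  refine tsum_congr fun y => ?_
  change kpow (fun a b => ENNReal.ofReal (Real.exp l) * onS p a b) n x y * f y = _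
  rw [kpow_const_mul, mul_assoc]

theorem iterate_mono {q : S → S → ℝ≥0∞} {f g : S → ℝ≥0∞} (h : ∀ y, f y ≤ g y) (n : ℕ) (x : S) :
    (app q)^[n] f x ≤ (app q)^[n] g x := by
  rw [app_iterate, app_iterate]
  exact ENNReal.tsum_le_tsum fun y => mul_le_mul' le_rfl (h y)

variable [Countable S]

/-- Numerator and denominator, rescaled by e^{ln}, converge to a common constant times ν(A) and
ν(S); the rescaling cancels in the quotient. Boundedness of `h` allows an arbitrary initial law. -/
theorem tendsto_condLaw {p : Option S → PMF (Option S)} {l : ℝ} {ν : PMF S} {h : S → ℝ≥0∞}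
    (h0 : ∀ x, h x ≠ 0) {B : ℝ≥0∞} (hB : B ≠ ⊤) (hhB : ∀ x, h x ≤ B)
    (hh : ∀ x, app (tilt p l) h x = h x) (hν0 : ∀ x, ν x ≠ 0)
    (hν : ∀ y, ∑' z, ν z * tilt p l z y = ν y)
    (hmix : ∀ a b, ∃ k z, kpow (tilt p l) k a z ≠ 0 ∧ kpow (tilt p l) k b z ≠ 0)
    {C : ℝ≥0∞} (hC : C ≠ ⊤) {n₀ : ℕ} (hn₀ : ∀ y, (app (tilt p l))^[n₀] 1 y ≤ C * h y)
    (μ : PMF S) (A : Set S) :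
    Tendsto (fun n => condLaw p μ n A) atTop (𝓝 (ν.toOuterMeasure A)) := by
  set q := tilt p l with hq
  set r := ENNReal.ofReal (Real.exp l) with hr
  have ht : ∀ x, h x ≠ ⊤ := fun x => ne_top_of_le_ne_top hB (hhB x)
  have hZ : ∑' y, ν y * h y ≠ ⊤ := by
    refine ne_top_of_le_ne_top hB ?_
    calc _ ≤ ∑' y, ν y * B := by gcongr with y; exact hhB y
      _ = B := by rw [ENNReal.tsum_mul_right, ν.tsum_coe, one_mul]
  have hW : ∑' x, μ x * h x ≠ ⊤ := by
    refine ne_top_of_le_ne_top hB ?_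
    calc _ ≤ ∑' y, μ y * B := by gcongr with y; exact hhB y
      _ = B := by rw [ENNReal.tsum_mul_right, μ.tsum_coe, one_mul]
  have hpos : ∀ m : PMF S, ∑' y, m y * h y ≠ 0 := fun m hm => by
    have h1 := fun y => (mul_eq_zero.1 (ENNReal.tsum_eq_zero.1 hm y)).resolve_right (h0 y)
    have := m.tsum_coe
    simp [h1] at this
  set Z := ∑' y, ν y * h y with hZdef
  set W := ∑' x, μ x * h x with hWdef
  have key : ∀ E : Set S, Tendsto (fun n => ∑' x, μ x * (app q)^[n] (E.indicator 1) x) atTop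
      (𝓝 (W * Z⁻¹ * ν.toOuterMeasure E)) := by
    intro E
    -- An indicator need not be dominated by a multiple of `h`, but its image after n₀ steps is.
    rw [← tendsto_add_atTop_iff_nat n₀]
    have hE1 : ∀ y, (app q)^[n₀] (E.indicator 1) y ≤ C * h y := fun y =>
      (iterate_mono (fun z => Set.indicator_le_self' (fun _ _ => zero_le) z) n₀ y).trans (hn₀ y)
    have hlim := fun x => tendsto_iterate_of_harmonic h0 ht hh hν0 hν hZ hmix hC hE1 x
    have hEν : ∑' y, ν y * (app q)^[n₀] (E.indicator 1) y = ν.toOuterMeasure E := by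
      rw [tsum_mul_iterate_of_invariant (c := 1) (by simpa using hν), one_pow, one_mul,
        tsum_mul_indicator_one]
    rw [hEν] at hlim
    have e : W * Z⁻¹ * ν.toOuterMeasure E =
        ∑' x, μ x * (h x * (Z⁻¹ * ν.toOuterMeasure E)) := by
      simp only [← mul_assoc, ENNReal.tsum_mul_right, hWdef]
    rw [e]
    refine tendsto_tsum_of_le (b := fun x => μ x * (C * B)) ?_ (fun n x => ?_) (fun x => ?_)
    · rw [ENNReal.tsum_mul_right, μ.tsum_coe, one_mul]; finiteness
    · gcongr
      rw [Function.iterate_add_apply]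
      calc _ ≤ (app q)^[n] (fun y => C * h y) x := iterate_mono hE1 n x
        _ ≤ C * h x := iterate_le_of_superharmonic (h := fun y => C * h y)
            (fun y => by rw [app_const_mul, hh]) n x
        _ ≤ C * B := by gcongr; exact hhB x
    · simp only [Function.iterate_add_apply]
      exact ENNReal.Tendsto.const_mul (hlim x) (Or.inr (μ.apply_ne_top x))
  have hcond : ∀ n, condLaw p μ n A = (∑' x, μ x * (app q)^[n] (Set.univ.indicator 1) x)⁻¹ *
      ∑' x, μ x * (app q)^[n] (A.indicator 1) x := by
    intro n
    have hrn0 : r ^ n ≠ 0 := pow_ne_zero n (ofReal_exp_ne_zero l)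
    have hrnt : r ^ n ≠ ⊤ := ENNReal.pow_ne_top ENNReal.ofReal_ne_top
    have e : ∀ f : S → ℝ≥0∞, ∑' x, μ x * (app q)^[n] f x =
        r ^ n * ∑' x, μ x * (app (onS p))^[n] f x := fun f => by
      rw [← ENNReal.tsum_mul_left]
      exact tsum_congr fun x => by rw [hq, app_tilt_iterate]; ring
    rw [condLaw_eq, e, e, Set.indicator_univ,
      ENNReal.mul_inv (Or.inl hrn0) (Or.inl hrnt)]
    rw [mul_mul_mul_comm, ENNReal.inv_mul_cancel hrn0 hrnt, one_mul]
  have huniv : ν.toOuterMeasure Set.univ = 1 := by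
    rw [PMF.toOuterMeasure_apply, Set.indicator_univ, ν.tsum_coe]
  have hc0 : W * Z⁻¹ ≠ 0 := mul_ne_zero (hpos μ) (ENNReal.inv_ne_zero.2 hZ)
  have hct : W * Z⁻¹ ≠ ⊤ := ENNReal.mul_ne_top hW (ENNReal.inv_ne_top.2 (hpos ν))
  simp only [hcond]
  have hu := key Set.univ
  rw [huniv, mul_one] at hu
  have hA := key A
  have := ENNReal.Tendsto.mul (tendsto_inv_iff.2 hu) (Or.inl (ENNReal.inv_ne_zero.2 hct)) hA
    (Or.inr (ENNReal.inv_ne_top.2 hc0))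
  rwa [← mul_assoc, ENNReal.inv_mul_cancel hc0 hct, one_mul] at this

end Limit

end

end QSD

/-! ### The theorem. -/

open QSD in
theorem mainTheorem5 {S : Type*} [Countable S]
    (p : Option S → PMF (Option S))
    (h_abs : p none = PMF.pure none)
    (h_moment : QSD.HasExpMoment p)
    (h_irr : QSD.IsIrreducibleOnS p)
    (lbar : ℝ) (h_lbar : 0 < lbar)
    (K : Set S) (h_fin : K.Finite) (h_nonempty : K.Nonempty) (h_proper : K ≠ Set.univ)
    (h_infinite : ∃ x : S, QSD.absMGF p lbar x = ⊤)
    (h_arrival : (⨆ x : S, ⨆ _ : x ∉ K,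
      ∫⁻ ω, QSD.expTime lbar (min (QSD.tauAbs ω) (QSD.tauSet K ω)) ∂(QSD.PrAt p x)) < ⊤) :
    (0 < QSD.lambdaCr p ∧ QSD.lambdaCr p ≤ lbar ∧ QSD.InfiniteRegime p ∧
      (∃ x : S, ∫⁻ ω, QSD.expTime (QSD.lambdaCr p) (min (QSD.tauAbs ω) (QSD.tau x ω))
        ∂(QSD.PrAt p x) < ⊤) ∧
      (∃ x : S, ∫⁻ ω in {ω | QSD.tau x ω < QSD.tauAbs ω},
        QSD.expTime (QSD.lambdaCr p) (QSD.tau x ω) * ((QSD.tau x ω : ℕ∞) : ℝ≥0∞)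
        ∂(QSD.PrAt p x) < ⊤) ∧
      (∀ x : S, x ∉ K →
        ∫⁻ ω, QSD.expTime (QSD.lambdaCr p) (min (QSD.tauAbs ω) (QSD.tauSet K ω))
        ∂(QSD.PrAt p x) < ⊤)) ∧
    ∃ ν : PMF S,
      QSD.IsQSD p ν ∧ (∀ ν' : PMF S, QSD.IsQSD p ν' → ν' = ν) ∧
      QSD.IsMinimalQSD p ν ∧
      (∀ x : S, ν x = ENNReal.ofReal (Real.exp (QSD.lambdaCr p) - 1) /
        ∫⁻ ω in {ω | QSD.tauAbs ω < QSD.tau x ω},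
          QSD.expTime (QSD.lambdaCr p) (QSD.tauAbs ω) ∂(QSD.PrAt p x)) ∧
      (QSD.IsAperiodicOnS p →
        (∃ x₀ : S, ∃ n₀ : ℕ, 1 ≤ n₀ ∧
          0 < ⨅ x : S, QSD.PrAt p x {ω | QSD.tau x₀ ω < QSD.tauAbs ω} /
            QSD.PrAt p x {ω | (n₀ : ℕ∞) < QSD.tauAbs ω}) →
        ∀ μ : PMF S, ∀ A : Set S,
          Tendsto (fun n : ℕ => QSD.condLaw p μ n A) atTop (𝓝 (ν.toOuterMeasure A))) := by
  have hirr := irr_onS h_irr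
  obtain ⟨k₀, hk₀⟩ := h_nonempty
  obtain ⟨xi, hxi⟩ := h_infinite
  have hbd : ∀ l ∈ {l : ℝ | 0 < l ∧ ∃ x : S, absMGF p l x < ⊤}, l ≤ lbar := by
    rintro l ⟨hl, y, hy⟩
    exact le_of_absMGF_lt_top hirr h_lbar hxi hl hy
  have hbdd : BddAbove {l : ℝ | 0 < l ∧ ∃ x : S, absMGF p l x < ⊤} := ⟨lbar, hbd⟩
  have hpos : 0 < lambdaCr p := lambdaCr_pos h_moment hbdd
  have hle : lambdaCr p ≤ lbar := by
    obtain ⟨b, hb, hx⟩ := h_moment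
    exact csSup_le ⟨b, hb, hx⟩ hbd
  obtain ⟨C, hC, hCbar⟩ := exists_pot_tab_le h_lbar h_arrival
  have hu : ∀ x, pot (tab K (tilt p (lambdaCr p))) 1 x ≤ C := fun x =>
    (pot_mono (fun a b => by
      simp only [tab]; split_ifs
      · exact le_rfl
      · exact tilt_mono p hle a b) (fun _ => le_rfl) x).trans (hCbar x)
  have hinf := pot_tilt_lambdaCr hirr hpos hbdd h_fin hC hu
  have hH := exists_pot_tab_singleton_le hirr h_moment h_fin hC hu
  have hHt : ∀ x y, pot (tab {x} (tilt p (lambdaCr p))) 1 y ≠ ⊤ := fun x y => by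
    obtain ⟨D, hD, h⟩ := hH x
    exact ne_top_of_le_ne_top hD (h y)
  have hhit : ∀ x, hit (tilt p (lambdaCr p)) x x = 1 := fun x =>
    le_antisymm (hit_tilt_le_one hirr h_moment x)
      (one_le_hit_self ENNReal.ofReal_ne_top (tsum_tilt_le p _) (hHt x) (hinf x))
  have hI := irr_tilt hirr (lambdaCr p)
  refine ⟨⟨hpos, hle, ⟨k₀, (absMGF_eq_top_iff p k₀ hpos).2 (hinf k₀)⟩, ⟨k₀, ?_⟩, ⟨k₀, ?_⟩, ?_⟩, ?_⟩
  · exact (lintegral_min_tau_lt_top_iff p k₀ k₀ hpos).2 (hHt k₀ k₀).lt_top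
  -- The excursion potential is bounded, so it stays finite at some l' above the critical parameter,
  -- and this margin absorbs the factor τ.
  · obtain ⟨D, hD, hDx⟩ := hH k₀
    obtain ⟨s, hs1, hst, hs⟩ := exists_pot_const_mul_le hD hDx
    obtain ⟨l', hl', he⟩ := const_mul_tilt p (lambdaCr p) hs1 hst
    rw [← tab_const_mul, he] at hs
    have hfin := (lintegral_min_tau_lt_top_iff p k₀ k₀ (hpos.trans hl')).2
      ((hs k₀).trans_lt (ENNReal.mul_lt_top (by simp) hD.lt_top))
    have hm : MeasurableSet {ω : ℕ → Option S | tau k₀ ω < tauAbs ω} :=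
      measurableSet_tau_lt_tauAbs k₀
    calc _ ≤ ∫⁻ ω in {ω | tau k₀ ω < tauAbs ω}, ENNReal.ofReal (l' - lambdaCr p)⁻¹ *
          expTime l' (min (tauAbs ω) (tau k₀ ω)) ∂(PrAt p k₀) := by
          refine setLIntegral_mono' hm fun ω hω => ?_
          rw [min_eq_right (le_of_lt hω)]
          exact expTime_mul_le hl' _
      _ ≤ ∫⁻ ω, ENNReal.ofReal (l' - lambdaCr p)⁻¹ *
          expTime l' (min (tauAbs ω) (tau k₀ ω)) ∂(PrAt p k₀) := setLIntegral_le_lintegral _ _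
      _ = ENNReal.ofReal (l' - lambdaCr p)⁻¹ * ∫⁻ ω,
          expTime l' (min (tauAbs ω) (tau k₀ ω)) ∂(PrAt p k₀) :=
          lintegral_const_mul' _ _ ENNReal.ofReal_ne_top
      _ < ⊤ := ENNReal.mul_lt_top ENNReal.ofReal_lt_top hfin
  · intro x _
    exact (lintegral_min_lt_top_iff p x K hpos).2 ((hu x).trans_lt hC.lt_top)
  · have : Nonempty S := ⟨k₀⟩
    obtain ⟨ν, hinv, hval, huniq⟩ := hI.exists_unique_invariant hhit fun x => hHt x x
    have hbdl : ∀ l < lambdaCr p, ∃ D, D ≠ ⊤ ∧ ∀ x, pot (tilt p l) 1 x ≤ D := fun l hl =>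
      exists_pot_le h_fin hC hu (tilt_mono p hl.le) (pot_tilt_ne_top_of_lt hirr h_moment hl)
    have heig := eigen_of_invariant hinv
    have hqsd : IsQSD p ν := isQSD_of_eigen (ofReal_exp_ne_zero _) ENNReal.ofReal_ne_top heig
    refine ⟨ν, hqsd, fun ν' h' => huniq ν' (h'.invariant hinf hbdl), ⟨hqsd, hpos, heig⟩,
      fun x => ?_, ?_⟩
    · have hr1 := one_lt_ofReal_exp hpos
      have hmk := mul_pot_kill hpos (hhit x) (hHt x x)
      rw [setLIntegral_expTime_tauAbs]
      change _ = _ / (_ * pot (tab {x} (tilt p (lambdaCr p))) _ x)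
      rw [hmk, hval x, ENNReal.ofReal_sub _ zero_le_one, ENNReal.ofReal_one]
      have h1 := (tsub_pos_of_lt hr1).ne'
      have h2 : ENNReal.ofReal (Real.exp (lambdaCr p)) - 1 ≠ ⊤ :=
        ENNReal.sub_ne_top ENNReal.ofReal_ne_top
      rw [ENNReal.div_eq_inv_mul, ENNReal.mul_inv (Or.inl h1) (Or.inl h2), mul_comm _⁻¹ (_)⁻¹,
        mul_assoc, ENNReal.inv_mul_cancel h1 h2, mul_one]
    · rintro hap ⟨x₀, n₀, -, hc⟩ μ A
      set c := ⨅ x : S, PrAt p x {ω | tau x₀ ω < tauAbs ω} /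
            PrAt p x {ω | (n₀ : ℕ∞) < tauAbs ω} with hcdef
      obtain ⟨D, hD, hDx⟩ := hH x₀
      have hx₀ := hhit x₀
      have hmix : ∀ a b, ∃ k z, kpow (tilt p (lambdaCr p)) k a z ≠ 0 ∧
          kpow (tilt p (lambdaCr p)) k b z ≠ 0 := by
        refine hI.exists_common fun x d hd => hap x d fun n hn h => hd n hn ?_
        rw [restrictedStep_eq] at h
        change 0 < kpow (fun a b => ENNReal.ofReal (Real.exp (lambdaCr p)) * onS p a b) n x x
        rw [kpow_const_mul]
        exact ENNReal.mul_pos (pow_ne_zero n (ofReal_exp_ne_zero _)) h.ne'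
      -- With `c` the infimum in the hypothesis, P_y(τ_Δ > n₀) ≤ c⁻¹ P_y(τ_{x₀} < τ_Δ), and the last
      -- probability is at most its tilted version h(y). Multiplying by e^{λ n₀} gives the constant
      -- `C`.
      refine tendsto_condLaw (h := hit (tilt p (lambdaCr p)) x₀) (hI.hit_ne_zero hx₀.le)
        (B := ENNReal.ofReal (Real.exp (lambdaCr p)) * D) (by finiteness)
        (fun x => (hit_le (tsum_tilt_le p _) x₀ x).trans (by gcongr; exact hDx x))
        (app_hit_eq hx₀) (fun x => ?_) hinv hmix
        (C := ENNReal.ofReal (Real.exp (lambdaCr p)) ^ n₀ * c⁻¹) ?_ (n₀ := n₀) (fun y => ?_) μ A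
      · rw [hval x]; exact ENNReal.inv_ne_zero.2 (hHt x x)
      · exact ENNReal.mul_ne_top (ENNReal.pow_ne_top ENNReal.ofReal_ne_top)
          (ENNReal.inv_ne_top.2 hc.ne')
      · rw [app_tilt_iterate, mul_assoc]
        gcongr
        have hle1 : onS p ≤ tilt p (lambdaCr p) := fun a b => by
          rw [tilt]; exact le_mul_of_one_le_left' (one_lt_ofReal_exp hpos).le
        have hP : PrAt p y {ω | (n₀ : ℕ∞) < tauAbs ω} = (app (onS p))^[n₀] 1 y := by
          have := PrAt_lt_retTime p y (A := {none}) rfl n₀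
          rwa [some_preimage_none, tab_empty] at this
        have hcy : c ≤ PrAt p y {ω | tau x₀ ω < tauAbs ω} /
            PrAt p y {ω | (n₀ : ℕ∞) < tauAbs ω} := iInf_le _ y
        have hhity : PrAt p y {ω | tau x₀ ω < tauAbs ω} ≤ hit (tilt p (lambdaCr p)) x₀ y :=
          (PrAt_tau_lt_tauAbs_le p x₀ y).trans (pot_mono (fun a b => by
            simp only [tab]; split_ifs
            · exact le_rfl
            · exact hle1 a b) (fun z => hle1 z x₀) y)
        rw [← hP]
        have h3 := ENNReal.mul_le_of_le_div hcy
        rw [mul_comm, ← div_eq_mul_inv, ENNReal.le_div_iff_mul_le (Or.inl hc.ne') ?_, mul_comm]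
        · exact h3.trans hhity
        · refine Or.inr (ne_top_of_le_ne_top (b := ENNReal.ofReal (Real.exp (lambdaCr p)) * D)
            (by finiteness) ?_)
          exact (hit_le (tsum_tilt_le p _) x₀ y).trans (by gcongr; exact hDx y)
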